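/- **Definitions.** Fix an integer $q\ge 2$ and an alphabet with $q$ letters. A word $U$ is an *instance* of a word $V$ if $U=\phi(V)$ for some homomorphism $\phi$ of free monoids that maps no letter to the empty word. Put $Z_0=\varepsilon$ and $Z_{n+1}=Z_nx_nZ_n$ with distinct letters $x_0,x_1,\dots$, so $Z_2=aba$ and $Z_3=abacaba$. Let $\mathbb I_n(V,q)$ be the proportion of the $q^n$ words of length $n$ that are instances of $V$, and $\mathbb I(V,q)=\lim_{n\to\infty}\mathbb I_n(V,q)$. A *bifix* of $W$ is a nonempty word that is both a proper initial string and a terminal string of $W$. A nonempty word is *bifix-free* if it has no bifix; $W$ is *$Z_2$-bifix-free* if no bifix of $W$ is a $Z_2$-instance. Let $a_\ell$ be the number of bifix-free words of length $\ell$. For a bifix-free word $L$ of length $\ell$, let $b_n^\ell$ be the number of $Z_2$-instances of length $n$ with bifix $L$ that are $Z_2$-bifix-free. **Theorem.** Let $q\ge2$. (A) For every $\ell\ge1$, every bifix-free word $L$ of length $\ell$ and every $n$, $b_n^\ell=c_n+d_n$ (in particular $b^\ell_n$ depends only on $q$, $\ell$, $n$), where $c_n=c_n^\ell$ and $d_n=d_n^\ell$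 are the integer sequences defined recursively as follows. *Even $\ell$.* $c_n=0$ for $n\le 2\ell$; $c_{2\ell+1}=q$; $$\begin{aligned} c_{4\ell}&=qc_{4\ell-1}-(c_{5\ell/2}+1),\\ c_{5\ell}&=qc_{5\ell-1}-(c_{5\ell/2}+c_{3\ell}-1),\\ c_{5\ell+1}&=q(c_{5\ell}+c_{3\ell}-1),\\ c_{6\ell}&=qc_{6\ell-1}-(c_{3\ell}-1+c_{7\ell/2}),\\ c_{2k}&=qc_{2k-1}-(c_k+c_{k+\ell/2})\quad (k>\ell,\ k\notin\{2\ell,5\ell/2,3\ell\}),\\ c_{2k+1}&=q(c_{2k}+c_{k+\ell/2})\quad (k>\ell,\ k\ne5\ell/2). \end{aligned}$$ $d_n=0$ for $n\le4\ell$; $d_{4\ell+1}=q$; $d_{5\ell}=qd_{5\ell-1}-1$; $d_{5\ell+1}=q(d_{5\ell}+1)$; $d_{6\ell}=qd_{6\ell-1}-1$; $$\begin{aligned} d_{2k}&=qd_{2k-1}-(d_k+d_{k+\ell}+d_{k+\ell/2})\quad(k>2\ell,\ k\notin\{5\ell/2,3\ell\}),\\ d_{2k+1}&=q(d_{2k}+d_{k+\ell}+d_{k+\ell/2})\quad(k>2\ell,\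 k\ne5\ell/2). \end{aligned}$$ *Odd $\ell>1$.* $c_n=0$ for $n\le 2\ell$; $c_{2\ell+1}=q$; $$\begin{aligned} c_{4\ell}&=q(c_{4\ell-1}+c_{\lfloor5\ell/2\rfloor})-(c_{2\ell}+1),\\ c_{5\ell}&=qc_{5\ell-1}-(c_{3\ell}-1),\\ c_{5\ell+1}&=q(c_{5\ell}+c_{3\ell}-1)-c_{\lceil5\ell/2\rceil},\\ c_{6\ell}&=q(c_{6\ell-1}+c_{\lfloor7\ell/2\rfloor})-(c_{3\ell}-1),\\ c_{2k}&=q(c_{2k-1}+c_{k+\lfloor\ell/2\rfloor})-c_k\quad(k>\ell,\ k\notin\{2\ell,\lceil5\ell/2\rceil,3\ell\}),\\ c_{2k+1}&=qc_{2k}-c_{k+\lceil\ell/2\rceil}\quad(k>\ell,\ k\ne\lfloor5\ell/2\rfloor). \end{aligned}$$ $d_n=0$ for $n\le4\ell$; $d_{4\ell+1}=q$; $d_{5\ell}=qd_{5\ell-1}-1$; $d_{5\ell+1}=q(d_{5\ell}+1)$; $d_{6\ell}=qd_{6\ell-1}-1$; $$\begin{aligned} d_{2k}&=q(d_{2k-1}+d_{k+\lfloor\ell/2\rfloor})-(d_k+d_{k+\ell})\quad(k>2\ell,\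 k\notin\{\lceil5\ell/2\rceil,3\ell\}),\\ d_{2k+1}&=q(d_{2k}+d_{k+\ell})-d_{k+\lceil\ell/2\rceil}\quad(k>2\ell,\ k\ne\lfloor5\ell/2\rfloor). \end{aligned}$$ *$\ell=1$.* $c_n=0$ for $n\le 2$; $c_3=q$; $c_4=qc_3-1$; $c_5=qc_4-(c_3-1)$; $c_6=q(c_5+c_3-1)-(c_3-1)$; $c_{2k}=q(c_{2k-1}+c_k)-c_k$ for $k>3$; $c_{2k+1}=qc_{2k}-c_{k+1}$ for $k>2$; $d_n=0$ for $n\le4$; $d_5=q-1$; $d_6=q(d_5+1)-1$; $d_{2k}=q(d_{2k-1}+d_k)-(d_k+d_{k+1})$ for $k>3$; $d_{2k+1}=q(d_{2k}+d_{k+1})-d_{k+1}$ for $k>2$. (B) The limit $\mathbb I(Z_3,q)$ exists, the series below converge (absolutely), and $$\mathbb I(Z_3,q)=\sum_{\ell=1}^{\infty}a_\ell\left(\sum_{i=0}^{\infty}\bigl(G(i)+H(i)\bigr)\right),$$ where $$\begin{aligned} G(i)=G_\ell^{(q)}(i)&=\frac{(-1)^i\,r\bigl(q^{-2^{i+1}}\bigr)\prod_{j=0}^{i-1}s\bigl(q^{-2^{j+1}}\bigr)}{\prod_{k=0}^{i}\bigl(1-q^{1-2^{k+1}}\bigr)},&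 H(i)=H_\ell^{(q)}(i)&=\frac{(-1)^i\,u\bigl(q^{-2^{i+1}}\bigr)\prod_{j=0}^{i-1}v\bigl(q^{-2^{j+1}}\bigr)}{\prod_{k=0}^{i}\bigl(1-q^{1-2^{k+1}}\bigr)}, \end{aligned}$$ $$\begin{aligned} r(x)&=qx^{2\ell+1}-x^{4\ell}+x^{5\ell}-qx^{5\ell+1}+x^{6\ell},\\ s(x)&=1-qx^{1-\ell}+x^{-\ell},\\ u(x)&=qx^{4\ell+1}-x^{5\ell}+qx^{5\ell+1}-x^{6\ell},\\ v(x)&=1-qx^{1-\ell}+x^{-\ell}-qx^{1-2\ell}+x^{-2\ell}. \end{aligned}$$ -/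

import Mathlib

open Filter Topology

namespace FreeWord

/-! Words over an alphabet `α` are lists of elements of `α`. -/

/-- `U` is an instance of `V`: it is the image of `V` under the nonerasing homomorphism of free
monoids that is determined by `φ`. -/
def IsInstance {α β : Type*} (V : List α) (U : List β) : Prop :=
  ∃ φ : α → List β, (∀ x, φ x ≠ []) ∧ U = V.flatMap φ

/-- The Zimin words `Z₀ = ε`, `Zₙ₊₁ = Zₙ xₙ Zₙ` over the letters `x₀, x₁, … = 0, 1, …`. -/
def zimin : ℕ → List ℕ
  | 0 => []
  | n + 1 => zimin n ++ [n] ++ zimin n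

/-- `U` is a bifix of `W`: a nonempty proper initial string of `W` that is also terminal. -/
def IsBifix {α : Type*} (U W : List α) : Prop :=
  U ≠ [] ∧ U ≠ W ∧ U <+: W ∧ U <:+ W

/-- Nonempty words without a bifix. -/
def BifixFree {α : Type*} (W : List α) : Prop :=
  W ≠ [] ∧ ∀ U, ¬ IsBifix U W

/-- `W` has no bifix that is a `V`-instance. -/
def InstanceBifixFree {α β : Type*} (V : List α) (W : List β) : Prop :=
  ∀ U, IsBifix U W → ¬ IsInstance V U

/-- The probability that a uniformly random word of length `n` over a `q`-letter alphabet is an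
instance of `V`. -/
noncomputable def instanceProb {α : Type*} (V : List α) (q n : ℕ) : ℝ :=
  ({W : List (Fin q) | W.length = n ∧ IsInstance V W}.ncard : ℝ) / (q : ℝ) ^ n

/-- The number of bifix-free words of length `ℓ` over a `q`-letter alphabet. -/
noncomputable def bifixFreeCount (q ℓ : ℕ) : ℕ :=
  {W : List (Fin q) | W.length = ℓ ∧ BifixFree W}.ncard

/-- The number of `Z₂`-instances of length `n` with bifix `L` that are `Z₂`-bifix-free. -/
noncomputable def z2BifixFreeCount {q : ℕ} (L : List (Fin q)) (n : ℕ) : ℕ :=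
  {W : List (Fin q) | W.length = n ∧ IsInstance (zimin 2) W ∧ IsBifix L W ∧
    InstanceBifixFree (zimin 2) W}.ncard

/-- The sequence `c_n = c_n^ℓ`. In the general branches `n = 2 * k` or `n = 2 * k + 1` with
`k = n / 2`; `(m + 1) / 2` is the ceiling of `m / 2`. -/
def cSeq (q ℓ : ℕ) (n : ℕ) : ℤ :=
  if _h0 : n ≤ 2 * ℓ then 0
  else if _h1 : n = 2 * ℓ + 1 then q
  else if _h2 : ℓ = 1 then
    if _h3 : n = 4 then q * cSeq q ℓ 3 - 1
    else if _h4 : n = 5 then q * cSeq q ℓ 4 - (cSeq q ℓ 3 - 1)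
    else if _h5 : n = 6 then q * (cSeq q ℓ 5 + cSeq q ℓ 3 - 1) - (cSeq q ℓ 3 - 1)
    else if _h6 : n % 2 = 0 then
      q * (cSeq q ℓ (n - 1) + cSeq q ℓ (n / 2)) - cSeq q ℓ (n / 2)
    else
      q * cSeq q ℓ (n - 1) - cSeq q ℓ (n / 2 + 1)
  else if _h7 : ℓ % 2 = 0 then
    if _h8 : n = 4 * ℓ then
      q * cSeq q ℓ (4 * ℓ - 1) - (cSeq q ℓ (5 * ℓ / 2) + 1)
    else if _h9 : n = 5 * ℓ then
      q * cSeq q ℓ (5 * ℓ - 1) - (cSeq q ℓ (5 * ℓ / 2) + cSeq q ℓ (3 * ℓ) - 1)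
    else if _h10 : n = 5 * ℓ + 1 then
      q * (cSeq q ℓ (5 * ℓ) + cSeq q ℓ (3 * ℓ) - 1)
    else if _h11 : n = 6 * ℓ then
      q * cSeq q ℓ (6 * ℓ - 1) - (cSeq q ℓ (3 * ℓ) - 1 + cSeq q ℓ (7 * ℓ / 2))
    else if _h12 : n % 2 = 0 then
      q * cSeq q ℓ (n - 1) - (cSeq q ℓ (n / 2) + cSeq q ℓ (n / 2 + ℓ / 2))
    else
      q * (cSeq q ℓ (n - 1) + cSeq q ℓ (n / 2 + ℓ / 2))
  else
    if _h13 : n = 4 * ℓ then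
      q * (cSeq q ℓ (4 * ℓ - 1) + cSeq q ℓ (5 * ℓ / 2)) - (cSeq q ℓ (2 * ℓ) + 1)
    else if _h14 : n = 5 * ℓ then
      q * cSeq q ℓ (5 * ℓ - 1) - (cSeq q ℓ (3 * ℓ) - 1)
    else if _h15 : n = 5 * ℓ + 1 then
      q * (cSeq q ℓ (5 * ℓ) + cSeq q ℓ (3 * ℓ) - 1) - cSeq q ℓ ((5 * ℓ + 1) / 2)
    else if _h16 : n = 6 * ℓ then
      q * (cSeq q ℓ (6 * ℓ - 1) + cSeq q ℓ (7 * ℓ / 2)) - (cSeq q ℓ (3 * ℓ) - 1)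
    else if _h17 : n % 2 = 0 then
      q * (cSeq q ℓ (n - 1) + cSeq q ℓ (n / 2 + ℓ / 2)) - cSeq q ℓ (n / 2)
    else
      q * cSeq q ℓ (n - 1) - cSeq q ℓ (n / 2 + (ℓ + 1) / 2)
termination_by n
decreasing_by all_goals omega

/-- The sequence `d_n = d_n^ℓ`, with the same conventions. -/
def dSeq (q ℓ : ℕ) (n : ℕ) : ℤ :=
  if _h0 : n ≤ 4 * ℓ then 0
  else if _h1 : ℓ = 1 then
    if _h2 : n = 5 then q - 1
    else if _h3 : n = 6 then q * (dSeq q ℓ 5 + 1) - 1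
    else if _h4 : n % 2 = 0 then
      q * (dSeq q ℓ (n - 1) + dSeq q ℓ (n / 2)) - (dSeq q ℓ (n / 2) + dSeq q ℓ (n / 2 + 1))
    else
      q * (dSeq q ℓ (n - 1) + dSeq q ℓ (n / 2 + 1)) - dSeq q ℓ (n / 2 + 1)
  else if _h5 : n = 4 * ℓ + 1 then q
  else if _h6 : n = 5 * ℓ then q * dSeq q ℓ (5 * ℓ - 1) - 1
  else if _h7 : n = 5 * ℓ + 1 then q * (dSeq q ℓ (5 * ℓ) + 1)
  else if _h8 : n = 6 * ℓ then q * dSeq q ℓ (6 * ℓ - 1) - 1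
  else if _h9 : ℓ % 2 = 0 then
    if _h10 : n % 2 = 0 then
      q * dSeq q ℓ (n - 1)
        - (dSeq q ℓ (n / 2) + dSeq q ℓ (n / 2 + ℓ) + dSeq q ℓ (n / 2 + ℓ / 2))
    else
      q * (dSeq q ℓ (n - 1) + dSeq q ℓ (n / 2 + ℓ) + dSeq q ℓ (n / 2 + ℓ / 2))
  else
    if _h11 : n % 2 = 0 then
      q * (dSeq q ℓ (n - 1) + dSeq q ℓ (n / 2 + ℓ / 2))
        - (dSeq q ℓ (n / 2) + dSeq q ℓ (n / 2 + ℓ))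
    else
      q * (dSeq q ℓ (n - 1) + dSeq q ℓ (n / 2 + ℓ)) - dSeq q ℓ (n / 2 + (ℓ + 1) / 2)
termination_by n
decreasing_by all_goals omega

noncomputable section

/-- `r(x) = q x^{2ℓ+1} - x^{4ℓ} + x^{5ℓ} - q x^{5ℓ+1} + x^{6ℓ}` -/
def rPoly (q ℓ : ℕ) (x : ℝ) : ℝ :=
  q * x ^ (2 * ℓ + 1) - x ^ (4 * ℓ) + x ^ (5 * ℓ) - q * x ^ (5 * ℓ + 1) + x ^ (6 * ℓ)

/-- `s(x) = 1 - q x^{1-ℓ} + x^{-ℓ}` (integer exponents) -/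
def sPoly (q ℓ : ℕ) (x : ℝ) : ℝ :=
  1 - q * x ^ (1 - (ℓ : ℤ)) + x ^ (-(ℓ : ℤ))

/-- `u(x) = q x^{4ℓ+1} - x^{5ℓ} + q x^{5ℓ+1} - x^{6ℓ}` -/
def uPoly (q ℓ : ℕ) (x : ℝ) : ℝ :=
  q * x ^ (4 * ℓ + 1) - x ^ (5 * ℓ) + q * x ^ (5 * ℓ + 1) - x ^ (6 * ℓ)

/-- `v(x) = 1 - q x^{1-ℓ} + x^{-ℓ} - q x^{1-2ℓ} + x^{-2ℓ}` (integer exponents) -/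
def vPoly (q ℓ : ℕ) (x : ℝ) : ℝ :=
  1 - q * x ^ (1 - (ℓ : ℤ)) + x ^ (-(ℓ : ℤ)) - q * x ^ (1 - 2 * (ℓ : ℤ)) + x ^ (-(2 * (ℓ : ℤ)))

/-- The point `q^{-2^{i+1}}`. -/
def node (q i : ℕ) : ℝ := (q : ℝ) ^ (-(2 : ℤ) ^ (i + 1))

/-- The denominator `∏_{k=0}^{i} (1 - q^{1-2^{k+1}})`. -/
def denom (q i : ℕ) : ℝ :=
  ∏ k ∈ Finset.range (i + 1), (1 - (q : ℝ) ^ (1 - (2 : ℤ) ^ (k + 1)))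

/-- `G(i) = G_ℓ^{(q)}(i)` -/
def termG (q ℓ i : ℕ) : ℝ :=
  (-1) ^ i * rPoly q ℓ (node q i) * (∏ j ∈ Finset.range i, sPoly q ℓ (node q j)) / denom q i

/-- `H(i) = H_ℓ^{(q)}(i)` -/
def termH (q ℓ i : ℕ) : ℝ :=
  (-1) ^ i * uPoly q ℓ (node q i) * (∏ j ∈ Finset.range i, vPoly q ℓ (node q j)) / denom q i

end

end FreeWord

open FreeWord

/-! A $Z_3$-instance is a word $ACA$ with $A$ a $Z_2$-instance and $C$ nonempty. The shortest such
border $A$ is $Z_2$-bifix-free, and it is unique because borders of one word are nested. With $p_m$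
the number of $Z_2$-bifix-free $Z_2$-instances of length $m$, this gives $\mathbb
I_n=\sum_{2m<n}p_mq^{n-2m}/q^n=\sum_{2m<n}p_mq^{-2m}$: the probabilities are partial sums of one
fixed series (`instanceProb_zimin_three`). The shortest nonempty border $L$ of $A$ is its only
bifix-free border, so $p_m$ splits as $\sum_\ell a_\ell b_m^\ell$.

For fixed $L$ every nonempty proper border other than $L$ has length at least $2\ell$, and it is a
$Z_2$-instance as soon as it is longer than $2\ell$. So $b_n^\ell$ counts the words of length
$n>2\ell$ whose longest proper border is $K=L$ or $K=LL$. These are counted by relaxing the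
condition to "no border longer than $K$ of at most half the length". Inserting a letter in the
middle preserves this, except that at even length $2k$ the squares $WW$ must be discarded, where $W$
has length $k$ and longest proper border $K$ (`ncard_shortBorderWords_succ`). The relaxed words not
wanted are two copies of a shorter wanted word overlapping in a nonempty border of $K$
(`shortBorderWords_eq`, `ncard_overlapWords`); that border is $L$ if $K=L$, and $L$ or $LL$ if
$K=LL$. The resulting recursions are those of $c_n$ and $d_n$, up to corrections at $2\ell$ and
$3\ell$.

For the generating functions the recursions read $(1-qx)F(x)=r(x)-s(x)F(x^2)$, and likewise with
$u,v$. Iterating from $x=q^{-2}$ produces the series of $G$ and $H$ (`hasSum_iterate`); it converges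
because $F$ vanishes at $0$ to a higher order than the pole of $s$ or $v$. The sums over $m$ and
$\ell$ are exchanged on the level of the nonnegative counts. -/

namespace FreeWord

variable {α : Type*}

/-! ### Borders -/

/-- `U` is a (possibly empty, possibly improper) border of `W`. -/
def Border (U W : List α) : Prop := U <+: W ∧ U <:+ W

theorem Border.refl (W : List α) : Border W W := ⟨List.prefix_refl W, List.suffix_refl W⟩

theorem Border.trans {U V W : List α} (h : Border U V) (h' : Border V W) : Border U W :=
  ⟨h.1.trans h'.1, h.2.trans h'.2⟩

theorem Border.length_le {U W : List α} (h : Border U W) : U.length ≤ W.length :=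
  h.1.length_le

theorem Border.eq_of_length {U W : List α} (h : Border U W) (hl : U.length = W.length) : U = W :=
  h.1.eq_of_length hl

theorem Border.length_lt {U W : List α} (h : Border U W) (hne : U ≠ W) : U.length < W.length :=
  lt_of_le_of_ne h.length_le fun e => hne (h.eq_of_length e)

theorem Border.of_length_le {U V W : List α} (hU : Border U W) (hV : Border V W)
    (h : U.length ≤ V.length) : Border U V :=
  ⟨List.prefix_of_prefix_length_le hU.1 hV.1 h, List.suffix_of_suffix_length_le hU.2 hV.2 h⟩

theorem Border.append {A B : List α} : Border A (A ++ (B ++ A)) :=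
  ⟨List.prefix_append _ _, by rw [← List.append_assoc]; exact List.suffix_append _ _⟩

theorem Border.append_self {A : List α} : Border A (A ++ A) :=
  ⟨List.prefix_append _ _, List.suffix_append _ _⟩

/-- A border of at most half the length splits the word. -/
theorem Border.exists_eq_append {U W : List α} (h : Border U W)
    (hl : 2 * U.length ≤ W.length) : ∃ M, W = U ++ (M ++ U) := by
  obtain ⟨⟨X, rfl⟩, Y, hY⟩ := h
  have : U <:+ X := by
    apply List.suffix_of_suffix_length_le ⟨Y, hY⟩ (List.suffix_append U X)
    simp at hl; omega
  obtain ⟨M, rfl⟩ := this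
  exact ⟨M, rfl⟩

/-- A border of more than half the length overlaps itself in one of its own borders. -/
theorem Border.exists_overlap {B W : List α} (h : Border B W)
    (hl : W.length < 2 * B.length) :
    ∃ O, Border O B ∧ O.length + W.length = 2 * B.length ∧ W = B ++ B.drop O.length := by
  obtain ⟨⟨X, rfl⟩, Y, hY⟩ := h
  rcases List.append_eq_append_iff.1 hY with ⟨c, h1, h2⟩ | ⟨a, -, rfl⟩
  · have hl' : (Y ++ B).length = (B ++ X).length := by rw [hY]
    have e1 := congrArg List.length h1
    simp only [List.length_append] at hl hl' e1
    refine ⟨c, ⟨⟨X, h2.symm⟩, ⟨Y, h1.symm⟩⟩, by simp only [List.length_append]; omega, ?_⟩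
    conv_rhs => rw [h2]
    rw [List.drop_left, ← h2]
  · simp only [List.length_append] at hl
    omega

/-- Two copies of `B` overlapping in the border `O`. -/
theorem Border.glue {O B : List α} (h : Border O B) : Border B (B ++ B.drop O.length) := by
  refine ⟨List.prefix_append _ _, ?_⟩
  obtain ⟨⟨X, rfl⟩, Y, hY⟩ := h
  rw [List.drop_left]
  exact ⟨Y, by rw [← List.append_assoc, hY]⟩

/-! ### Counting words by their longest proper border -/

theorem finite_words [Finite α] (n : ℕ) : {W : List α | W.length = n}.Finite :=
  List.finite_length_eq α n

theorem ncard_words [Fintype α] (n : ℕ) :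
    {W : List α | W.length = n}.ncard = Fintype.card α ^ n := by
  rw [← card_vector n, ← Nat.card_eq_fintype_card]
  rfl

/-- Words of length `m` whose longest proper border is `K`. -/
def maxBorderWords (K : List α) (m : ℕ) : Set (List α) :=
  {W | W.length = m ∧ Border K W ∧ K ≠ W ∧ ∀ U, Border U W → U ≠ W → U.length ≤ K.length}

/-- Words of length `m` with border `K` and no longer border of at most half the length. -/
def shortBorderWords (K : List α) (m : ℕ) : Set (List α) :=
  {W | W.length = m ∧ Border K W ∧ ∀ U, Border U W → 2 * U.length ≤ m → U.length ≤ K.length}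

/-- Pairs of words of length `h` that begin resp. end with `K`, such that no word longer than `K`
and of length at most `b` is both a prefix of the first and a suffix of the second. -/
def splitPairs (K : List α) (h b : ℕ) : Set (List α × List α) :=
  {p | p.1.length = h ∧ p.2.length = h ∧ K <+: p.1 ∧ K <:+ p.2 ∧
    ∀ U, U <+: p.1 → U <:+ p.2 → U.length ≤ b → U.length ≤ K.length}

variable {K : List α}

theorem finite_maxBorderWords [Finite α] (m : ℕ) : (maxBorderWords K m).Finite :=
  (finite_words m).subset fun _ h => h.1

theorem finite_splitPairs [Finite α] (h b : ℕ) : (splitPairs K h b).Finite :=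
  ((finite_words h).prod (finite_words h)).subset fun _ hp => ⟨hp.1, hp.2.1⟩

theorem ncard_maxBorderWords_le [Fintype α] (m : ℕ) :
    (maxBorderWords K m).ncard ≤ Fintype.card α ^ m := by
  rw [← ncard_words]
  exact Set.ncard_le_ncard (fun _ h => h.1) (finite_words m)

theorem splitPairs_length : splitPairs K K.length K.length = {(K, K)} := by
  ext ⟨A, B⟩
  simp only [splitPairs, Set.mem_ofPred_eq, Set.mem_singleton_iff, Prod.mk.injEq]
  constructor
  · rintro ⟨h1, h2, h3, h4, -⟩
    exact ⟨(h3.eq_of_length h1.symm).symm, (h4.eq_of_length h2.symm).symm⟩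
  · rintro ⟨rfl, rfl⟩
    exact ⟨rfl, rfl, List.prefix_refl _, List.suffix_refl _, fun _ _ _ h => h⟩

/-- A letter added at the inner end of each half does not affect prefixes and suffixes of length at
most `h`, so all pairs of letters are allowed. -/
theorem ncard_splitPairs_succ_left [Fintype α] {h : ℕ} (hK : K.length ≤ h) :
    (splitPairs K (h + 1) h).ncard = Fintype.card α ^ 2 * (splitPairs K h h).ncard := by
  have : splitPairs K (h + 1) h =
      (fun x : (List α × List α) × (α × α) => (x.1.1 ++ [x.2.1], x.2.2 :: x.1.2)) ''
        (splitPairs K h h ×ˢ Set.univ) := by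
    ext ⟨A, B⟩
    constructor
    · rintro ⟨h1, h2, h3, h4, h5⟩
      dsimp only at h1 h2 h3 h4 h5
      obtain ⟨A', a, rfl⟩ : ∃ A' a, A = A' ++ [a] := by
        rcases List.eq_nil_or_concat A with rfl | ⟨A', a, e⟩
        · simp at h1
        · exact ⟨A', a, by simpa using e⟩
      obtain ⟨b, B', rfl⟩ : ∃ b B', B = b :: B' := by
        cases B with
        | nil => simp at h2
        | cons b B' => exact ⟨b, B', rfl⟩
      simp only [List.length_append, List.length_cons, List.length_nil] at h1 h2
      refine ⟨((A', B'), (a, b)), ?_, rfl⟩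
      refine ⟨⟨Nat.succ.inj h1, Nat.succ.inj h2, ?_, ?_, ?_⟩, trivial⟩
      · exact List.prefix_of_prefix_length_le h3 (List.prefix_append _ _)
          (by dsimp only; omega)
      · exact List.suffix_of_suffix_length_le h4 (List.suffix_cons _ _)
          (by dsimp only; omega)
      · intro U hU hU' hl
        exact h5 U (hU.trans (List.prefix_append _ _)) (hU'.trans (List.suffix_cons _ _)) hl
    · rintro ⟨⟨⟨A', B'⟩, a, b⟩, ⟨⟨h1, h2, h3, h4, h5⟩, -⟩, e⟩
      obtain ⟨rfl, rfl⟩ := Prod.mk.inj e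
      dsimp only at h1 h2 h3 h4 h5 ⊢
      refine ⟨by simp [h1], by simp [h2], h3.trans (List.prefix_append _ _),
        h4.trans (List.suffix_cons _ _), ?_⟩
      intro U hU hU' hl
      exact h5 U
        (List.prefix_of_prefix_length_le hU (List.prefix_append _ _) (by dsimp only at *; omega))
        (List.suffix_of_suffix_length_le hU' (List.suffix_cons _ _) (by dsimp only at *; omega)) hl
  rw [this, Set.ncard_image_of_injective, Set.ncard_prod, Set.ncard_univ,
    Nat.card_eq_fintype_card, Fintype.card_prod]
  · ring
  · rintro ⟨⟨A, B⟩, a, b⟩ ⟨⟨A', B'⟩, a', b'⟩ e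
    simp only [Prod.mk.injEq, List.cons.injEq] at e
    obtain ⟨e1, rfl, rfl⟩ := e
    obtain ⟨rfl, e2⟩ := List.append_inj' e1 rfl
    simp at e2
    simp [e2]

/-- Raising the bound to the full length only adds a condition on `U` of length `h + 1`. Such a `U`
equals both halves, so the pairs lost are `(W, W)`, and the old condition says that `K` is the
longest proper border of `W`. -/
theorem ncard_splitPairs_succ_right [Fintype α] {h : ℕ} (hK : K.length ≤ h) :
    (splitPairs K (h + 1) h).ncard =
      (splitPairs K (h + 1) (h + 1)).ncard + (maxBorderWords K (h + 1)).ncard := by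
  have inj : Function.Injective fun W : List α => (W, W) := fun _ _ e => (Prod.mk.inj e).1
  rw [← Set.ncard_image_of_injective (maxBorderWords K (h + 1)) inj, ← Set.ncard_union_eq _
    (finite_splitPairs _ _) ((finite_maxBorderWords _).image _)]
  · congr 1
    ext ⟨A, B⟩
    constructor
    · rintro ⟨h1, h2, h3, h4, h5⟩
      dsimp only at h1 h2 h3 h4 h5
      by_cases hAB : A = B
      · subst hAB
        refine Or.inr ⟨A, ⟨h1, ⟨h3, h4⟩, ?_, ?_⟩, rfl⟩
        · rintro rfl; omega
        · intro U hU hne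
          have := hU.length_lt hne
          exact h5 U hU.1 hU.2 (by omega)
      · refine Or.inl ⟨h1, h2, h3, h4, ?_⟩
        intro U hU hU' hl
        dsimp only at hU hU'
        rcases Nat.lt_or_eq_of_le hl with hl | hl
        · exact h5 U hU hU' (by omega)
        · exact absurd ((hU.eq_of_length (by omega)).symm.trans
            (hU'.eq_of_length (by omega))) hAB
    · rintro (⟨h1, h2, h3, h4, h5⟩ | ⟨W, ⟨h1, h2, h3, h4⟩, e⟩)
      · exact ⟨h1, h2, h3, h4, fun U hU hU' hl => h5 U hU hU' (by omega)⟩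
      · obtain ⟨rfl, rfl⟩ := Prod.mk.inj e
        refine ⟨h1, h1, h2.1, h2.2, fun U hU hU' hl => h4 U ⟨hU, hU'⟩ ?_⟩
        rintro rfl; omega
  · rw [Set.disjoint_left]
    rintro _ ⟨h1, h2, h3, h4, h5⟩ ⟨W, hW, rfl⟩
    have := h5 W (List.prefix_refl _) (List.suffix_refl _) hW.1.le
    have := hW.1
    omega

theorem ncard_splitPairs_succ [Fintype α] {h : ℕ} (hK : K.length ≤ h) :
    (splitPairs K (h + 1) (h + 1)).ncard + (maxBorderWords K (h + 1)).ncard =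
      Fintype.card α ^ 2 * (splitPairs K h h).ncard := by
  rw [← ncard_splitPairs_succ_right hK, ncard_splitPairs_succ_left hK]

theorem border_append_append {A M B : List α} {U : List α} (hA : U.length ≤ A.length)
    (hB : U.length ≤ B.length) : Border U (A ++ (M ++ B)) ↔ U <+: A ∧ U <:+ B := by
  constructor
  · rintro ⟨h1, h2⟩
    refine ⟨List.prefix_of_prefix_length_le h1 (List.prefix_append _ _) hA,
      List.suffix_of_suffix_length_le h2 ?_ hB⟩
    rw [← List.append_assoc]; exact List.suffix_append _ _
  · rintro ⟨h1, h2⟩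
    refine ⟨h1.trans (List.prefix_append _ _), h2.trans ?_⟩
    rw [← List.append_assoc]; exact List.suffix_append _ _

/-- Borders of at most half the length are visible in the two outer halves; the middle letter,
present when `e = 1`, is free. -/
theorem ncard_shortBorderWords_aux [Fintype α] {h e : ℕ} (he : e ≤ 1) (hK : K.length ≤ h) :
    (shortBorderWords K (2 * h + e)).ncard = Fintype.card α ^ e * (splitPairs K h h).ncard := by
  have : shortBorderWords K (2 * h + e) =
      (fun x : (List α × List α) × List α => x.1.1 ++ (x.2 ++ x.1.2)) ''
        (splitPairs K h h ×ˢ {M | M.length = e}) := by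
    ext W
    constructor
    · rintro ⟨h1, h2, h3⟩
      obtain ⟨A, M, B, rfl, hA, hM, hB⟩ : ∃ A M B : List α, W = A ++ (M ++ B) ∧ A.length = h ∧
          M.length = e ∧ B.length = h := by
        refine ⟨W.take h, (W.drop h).take e, (W.drop h).drop e, ?_, ?_, ?_, ?_⟩
        · simp only [List.take_append_drop]
        all_goals simp; omega
      have := (border_append_append (M := M) (hA ▸ hK) (hB ▸ hK)).1 h2
      refine ⟨((A, B), M), ⟨⟨hA, hB, this.1, this.2, ?_⟩, hM⟩, rfl⟩
      intro U hU hU' hl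
      exact h3 U ((border_append_append (by omega) (by omega)).2 ⟨hU, hU'⟩) (by omega)
    · rintro ⟨⟨⟨A, B⟩, M⟩, ⟨⟨h1, h2, h3, h4, h5⟩, h6⟩, rfl⟩
      dsimp only at h1 h2 h3 h4 h5 h6 ⊢
      simp only [Set.mem_ofPred_eq] at h6
      refine ⟨by simp; omega, (border_append_append (by omega) (by omega)).2 ⟨h3, h4⟩, ?_⟩
      intro U hU hl
      have := (border_append_append (by omega) (by omega)).1 hU
      exact h5 U this.1 this.2 (by omega)
  rw [this, Set.InjOn.ncard_image, Set.ncard_prod, ncard_words, mul_comm]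
  rintro ⟨⟨A, B⟩, M⟩ ⟨h, hM⟩ ⟨⟨A', B'⟩, M'⟩ ⟨h', hM'⟩ e
  obtain ⟨rfl, e2⟩ := List.append_inj e (h.1.trans h'.1.symm)
  obtain ⟨rfl, rfl⟩ := List.append_inj e2 (hM.trans hM'.symm)
  rfl

/-- `f (n / 2)` for even `n`, and `0` for odd `n`. -/
def halve {R : Type*} [Zero R] (f : ℕ → R) (n : ℕ) : R := if n % 2 = 0 then f (n / 2) else 0

theorem halve_two_mul {R : Type*} [Zero R] (f : ℕ → R) (n : ℕ) : halve f (2 * n) = f n := by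
  simp [halve]

theorem halve_odd {R : Type*} [Zero R] (f : ℕ → R) {n : ℕ} (h : n % 2 = 1) : halve f n = 0 := by
  simp [halve, h]

/-- From even to odd length a free middle letter appears. From odd to even length it disappears and
both halves grow by a letter, at the cost of the squares of words with longest proper border `K`. -/
theorem ncard_shortBorderWords_succ [Fintype α] {n : ℕ} (hn : 2 * K.length ≤ n) :
    (shortBorderWords K (n + 1)).ncard + halve (fun m => (maxBorderWords K m).ncard) (n + 1) =
      Fintype.card α * (shortBorderWords K n).ncard := by
  obtain ⟨h, rfl | rfl⟩ := Nat.even_or_odd' n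
  · have h0 : K.length ≤ h := by omega
    rw [ncard_shortBorderWords_aux le_rfl h0, halve_odd _ (by omega)]
    have := ncard_shortBorderWords_aux (K := K) zero_le_one h0
    rw [add_zero] at this
    rw [this]; ring
  · have h0 : K.length ≤ h := by omega
    have := ncard_shortBorderWords_aux (K := K) zero_le_one (h0.trans h.le_succ)
    rw [add_zero] at this
    rw [show 2 * h + 1 + 1 = 2 * (h + 1) by ring, this, halve_two_mul,
      ncard_shortBorderWords_aux le_rfl h0, pow_zero, one_mul, ncard_splitPairs_succ h0]
    ring

/-- The words of `shortBorderWords K m` whose shortest border longer than `K` overlaps itself in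
`j` letters. -/
def overlapWords (K : List α) (j m : ℕ) : Set (List α) :=
  {W | W.length = m ∧ ∃ B k, 2 * k = m + j ∧ k < m ∧ B ∈ maxBorderWords K k ∧ Border B W}

/-- The overlap length fixes `|B|`, and `B` and `O` determine the word. Conversely any such `B` ends
and begins with `O`, because `O` is a border of `K` and `K` of `B`, so two copies can be glued. -/
theorem ncard_overlapWords [Fintype α] {O : List α} (hO : Border O K) {m : ℕ}
    (hm : O.length < m) :
    (overlapWords K O.length m).ncard =
      halve (fun k => (maxBorderWords K k).ncard) (m + O.length) := by
  by_cases hpar : (m + O.length) % 2 = 0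
  · obtain ⟨k, hk⟩ : ∃ k, m + O.length = 2 * k := ⟨(m + O.length) / 2, by omega⟩
    rw [hk, halve_two_mul]
    symm
    refine Set.ncard_congr (fun B _ => B ++ B.drop O.length) ?_ ?_ ?_
    · intro B hB
      have hl := hB.1
      exact ⟨by simp; omega, B, k, hk.symm, by omega, hB, (hO.trans hB.2.1).glue⟩
    · intro B B' hB hB' e
      exact (List.append_inj e (hB.1.trans hB'.1.symm)).1
    · rintro W ⟨hW, B, k', hk', -, hB, hBW⟩
      obtain rfl : k' = k := by omega
      have hl := hB.1
      refine ⟨B, hB, ?_⟩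
      -- Without a proper overlap the length equation forces `O = []` and `W = B ++ B`.
      by_cases h0 : W.length < 2 * B.length
      · obtain ⟨O', -, h2, h3⟩ := hBW.exists_overlap h0
        rw [show O'.length = O.length by omega] at h3
        exact h3.symm
      · obtain ⟨M, rfl⟩ := hBW.exists_eq_append (by omega)
        have : O = [] := List.eq_nil_of_length_eq_zero (by omega)
        subst this
        have : M = [] := List.eq_nil_of_length_eq_zero (by
          simp only [List.length_append, List.length_nil] at hW hk; omega)
        subst this
        simp
  · rw [halve_odd _ (by omega)]
    convert Set.ncard_empty (List α)
    rw [Set.eq_empty_iff_forall_notMem]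
    rintro W ⟨-, B, k, hk, -⟩
    omega

/-- A larger overlap means a longer `B'`. The shorter `B` would then be a proper border of `B'`
longer than `K`. -/
theorem disjoint_overlapWords {j j' m : ℕ} (hj : j < j') :
    Disjoint (overlapWords K j m) (overlapWords K j' m) := by
  rw [Set.disjoint_left]
  rintro W ⟨-, B, k, hk, hkm, hB, hBW⟩ ⟨-, B', k', hk', hkm', hB', hBW'⟩
  have h1 := hB.1
  have h2 := hB'.1
  have h3 := hB'.2.2.2 B (hBW.of_length_le hBW' (by omega)) (by rintro rfl; omega)
  have := hB.2.1.length_lt hB.2.2.1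
  omega

theorem disjoint_maxBorderWords_overlapWords {j m : ℕ} :
    Disjoint (maxBorderWords K m) (overlapWords K j m) := by
  rw [Set.disjoint_left]
  rintro W hW ⟨-, B, k, hk, hkm, hB, hBW⟩
  have h1 := hB.2.1.length_lt hB.2.2.1
  have := hW.2.2.2 B hBW (by rintro rfl; have := hW.1; have := hB.1; omega)
  omega

/-- A word without a long border of at most half its length has `K` as its longest proper border,
or has a border that overlaps itself in a nonempty border of `K`. -/
theorem shortBorderWords_eq {m : ℕ} (hm : K.length < m) :
    shortBorderWords K m = maxBorderWords K m ∪
      {W | ∃ O, O ≠ [] ∧ Border O K ∧ W ∈ overlapWords K O.length m} := by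
  ext W
  constructor
  · rintro ⟨h1, h2, h3⟩
    by_cases hW : W ∈ maxBorderWords K m
    · exact Or.inl hW
    · right
      have hne : K ≠ W := by rintro rfl; omega
      -- The shortest border `B` longer than `K`: by minimality its own longest proper border is
      -- `K`, and `B` exceeds half of `W`, so it overlaps itself.
      have hex : ∃ k, ∃ U, Border U W ∧ U ≠ W ∧ K.length < U.length ∧ U.length = k := by
        by_contra! hcon
        refine hW ⟨h1, h2, hne, fun U hU hUW => ?_⟩
        by_contra! hlt
        exact hcon _ U hU hUW hlt rfl
      classical
      obtain ⟨B, hB, hBW, hKB, hk⟩ := Nat.find_spec hex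
      have hmin : ∀ U, Border U W → U.length < B.length → U.length ≤ K.length := by
        intro U hU hUB
        by_contra! hlt
        exact Nat.find_min hex (hk ▸ hUB) ⟨U, hU, by rintro rfl; have := hB.length_le; omega,
          hlt, rfl⟩
      have hlong : W.length < 2 * B.length := by
        by_contra! hle
        have := h3 B hB (by omega)
        omega
      have hBl := hB.length_lt hBW
      obtain ⟨O, hO, hOl, -⟩ := hB.exists_overlap hlong
      have hOK : O.length ≤ K.length := hmin O (hO.trans hB) (by omega)
      refine ⟨O, by rintro rfl; simp at hOl; omega, (hO.trans hB).of_length_le h2 hOK,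
        h1, B, B.length, by omega, by omega, ⟨rfl, h2.of_length_le hB hKB.le, ?_, ?_⟩, hB⟩
      · rintro rfl; omega
      · intro U hU hne
        exact hmin U (hU.trans hB) (hU.length_lt hne)
  · rintro (⟨h1, h2, h3, h4⟩ | ⟨O, hO, hOK, h1, B, k, hk, hkm, hB, hBW⟩)
    · refine ⟨h1, h2, fun U hU hl => h4 U hU ?_⟩
      rintro rfl; omega
    · refine ⟨h1, hB.2.1.trans hBW, fun U hU hl => ?_⟩
      have hBl := hB.1
      have hO' := List.length_pos_of_ne_nil hO
      -- The overlap `O` is nonempty, so `B` is longer than half of `W` and `U` is a proper border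
      -- of `B`.
      exact hB.2.2.2 U (hU.of_length_le hBW (by omega)) (by rintro rfl; omega)

theorem finite_overlapWords [Finite α] (j m : ℕ) : (overlapWords K j m).Finite :=
  (finite_words m).subset fun _ h => h.1

variable {L : List α}

/-! ### Bifix-free cores -/

theorem BifixFree.length_pos (hL : BifixFree L) : 0 < L.length :=
  List.length_pos_of_ne_nil hL.1

theorem BifixFree.eq_of_border (hL : BifixFree L) {U : List α} (hU : Border U L) (h : U ≠ []) :
    U = L := by
  by_contra hne
  exact hL.2 U ⟨h, hne, hU⟩

theorem BifixFree.border (hL : BifixFree L) {U W : List α} (hLW : Border L W) (hU : Border U W)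
    (h : U ≠ []) : Border L U := by
  rcases le_total L.length U.length with hl | hl
  · exact hLW.of_length_le hU hl
  · rw [hL.eq_of_border (hU.of_length_le hLW hl) h]
    exact Border.refl L

/-- Two occurrences of `L` that overlapped without coinciding would give `L` a bifix. -/
theorem BifixFree.two_mul_length_le (hL : BifixFree L) {W : List α} (hLW : Border L W)
    (hne : L ≠ W) : 2 * L.length ≤ W.length := by
  by_contra! hlt
  obtain ⟨O, hO, hl, -⟩ := hLW.exists_overlap hlt
  have := hLW.length_lt hne
  have h0 : O ≠ [] := by rintro rfl; simp at hl; omega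
  have := congrArg List.length (hL.eq_of_border hO h0)
  omega

theorem Border.eq_append_self {W : List α} (hLW : Border L W)
    (hl : W.length = 2 * L.length) : W = L ++ L := by
  obtain ⟨M, rfl⟩ := hLW.exists_eq_append hl.ge
  obtain rfl : M = [] := List.eq_nil_of_length_eq_zero (by simp at hl; omega)
  rfl

theorem BifixFree.border_append_self (hL : BifixFree L) {U : List α} (hU : Border U (L ++ L))
    (h : U ≠ []) : U = L ∨ U = L ++ L := by
  by_contra! hne
  have h1 := hL.two_mul_length_le (hL.border Border.append_self hU h) (Ne.symm hne.1)
  have h2 := hU.length_lt hne.2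
  simp at h2
  omega

section counting

variable [Fintype α]

theorem BifixFree.ncard_shortBorderWords (hL : BifixFree L) {m : ℕ} (hm : L.length < m) :
    (shortBorderWords L m).ncard = (maxBorderWords L m).ncard +
      halve (fun k => (maxBorderWords L k).ncard) (m + L.length) := by
  rw [shortBorderWords_eq hm, ← ncard_overlapWords (Border.refl L) hm, ← Set.ncard_union_eq
    disjoint_maxBorderWords_overlapWords (finite_maxBorderWords m) (finite_overlapWords _ m)]
  congr 2
  ext W
  constructor
  · rintro ⟨O, h0, hO, hW⟩
    rwa [hL.eq_of_border hO h0] at hW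
  · exact fun hW => ⟨L, hL.1, Border.refl L, hW⟩

theorem BifixFree.ncard_shortBorderWords_append_self (hL : BifixFree L) {m : ℕ}
    (hm : 2 * L.length < m) :
    (shortBorderWords (L ++ L) m).ncard = (maxBorderWords (L ++ L) m).ncard +
      (halve (fun k => (maxBorderWords (L ++ L) k).ncard) (m + L.length) +
        halve (fun k => (maxBorderWords (L ++ L) k).ncard) (m + 2 * L.length)) := by
  have hLL : (L ++ L).length = 2 * L.length := by simp; ring
  have hpos := hL.length_pos
  have h1 := ncard_overlapWords (K := L ++ L) (O := L) (m := m) Border.append_self (by omega)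
  have h2 := ncard_overlapWords (Border.refl (L ++ L)) (m := m) (by omega)
  rw [← hLL, shortBorderWords_eq (by omega), ← h1, ← h2,
    ← Set.ncard_union_eq (disjoint_overlapWords (by omega)) (finite_overlapWords _ m)
      (finite_overlapWords _ m), ← Set.ncard_union_eq
    (Set.disjoint_union_right.2
      ⟨disjoint_maxBorderWords_overlapWords, disjoint_maxBorderWords_overlapWords⟩)
    (finite_maxBorderWords m) ((finite_overlapWords _ m).union (finite_overlapWords _ m))]
  congr 2
  ext W
  constructor
  · rintro ⟨O, h0, hO, hW⟩
    rcases hL.border_append_self hO h0 with rfl | rfl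
    · exact Or.inl hW
    · exact Or.inr hW
  · rintro (hW | hW)
    · exact ⟨L, hL.1, Border.append_self, hW⟩
    · exact ⟨L ++ L, by simp [hL.1], Border.refl _, hW⟩

theorem BifixFree.ncard_maxBorderWords_succ (hL : BifixFree L) {n : ℕ} (hn : 2 * L.length ≤ n) :
    (maxBorderWords L (n + 1)).ncard +
        halve (fun k => (maxBorderWords L k).ncard) (n + 1 + L.length) +
        halve (fun k => (maxBorderWords L k).ncard) (n + 1) =
      Fintype.card α * ((maxBorderWords L n).ncard +
        halve (fun k => (maxBorderWords L k).ncard) (n + L.length)) := by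
  have hpos := hL.length_pos
  rw [← hL.ncard_shortBorderWords (by omega), ← hL.ncard_shortBorderWords (by omega),
    ncard_shortBorderWords_succ hn]

theorem BifixFree.ncard_maxBorderWords_append_self_succ (hL : BifixFree L) {n : ℕ}
    (hn : 4 * L.length ≤ n) :
    (maxBorderWords (L ++ L) (n + 1)).ncard +
        (halve (fun k => (maxBorderWords (L ++ L) k).ncard) (n + 1 + L.length) +
        halve (fun k => (maxBorderWords (L ++ L) k).ncard) (n + 1 + 2 * L.length)) +
        halve (fun k => (maxBorderWords (L ++ L) k).ncard) (n + 1) =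
      Fintype.card α * ((maxBorderWords (L ++ L) n).ncard +
        (halve (fun k => (maxBorderWords (L ++ L) k).ncard) (n + L.length) +
        halve (fun k => (maxBorderWords (L ++ L) k).ncard) (n + 2 * L.length))) := by
  have hpos := hL.length_pos
  rw [← hL.ncard_shortBorderWords_append_self (by omega),
    ← hL.ncard_shortBorderWords_append_self (by omega),
    ncard_shortBorderWords_succ (by simp; omega)]

end counting

/-! ### Initial values of the two counts -/

theorem BifixFree.maxBorderWords_two_mul (hL : BifixFree L) :
    maxBorderWords L (2 * L.length) = {L ++ L} := by
  have hpos := hL.length_pos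
  ext W
  constructor
  · exact fun hW => hW.2.1.eq_append_self hW.1
  · rintro rfl
    refine ⟨by simp; ring, Border.append_self, by simp [hL.1], fun U hU hne => ?_⟩
    rcases eq_or_ne U [] with rfl | h0
    · simp
    · rcases hL.border_append_self hU h0 with rfl | rfl
      · exact le_rfl
      · exact absurd rfl hne

theorem BifixFree.maxBorderWords_of_lt (hL : BifixFree L) {m : ℕ} (hm : m < 2 * L.length) :
    maxBorderWords L m = ∅ := by
  rw [Set.eq_empty_iff_forall_notMem]
  rintro W ⟨h1, h2, h3, -⟩
  have := hL.two_mul_length_le h2 h3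
  omega

/-- The two copies of `LL` overlap in a nonempty border of `LL`. This is `L`, since the overlap `LL`
would make the copies coincide. -/
theorem BifixFree.length_of_border_append_self (hL : BifixFree L) {W : List α}
    (hW : Border (L ++ L) W) (hne : L ++ L ≠ W) (hl : W.length < 4 * L.length) :
    W = L ++ (L ++ L) := by
  obtain ⟨O, hO, hOl, hOW⟩ := hW.exists_overlap (by simp; omega)
  have hlt := hW.length_lt hne
  simp only [List.length_append] at hOl hlt
  have h0 : O ≠ [] := by rintro rfl; simp only [List.length_nil] at hOl; omega
  rcases hL.border_append_self hO h0 with rfl | rfl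
  · rw [hOW]; simp
  · simp only [List.length_append] at hOl
    omega

theorem BifixFree.maxBorderWords_append_self_three_mul (hL : BifixFree L) :
    maxBorderWords (L ++ L) (3 * L.length) = {L ++ (L ++ L)} := by
  have hpos := hL.length_pos
  have hB : Border (L ++ L) (L ++ (L ++ L)) :=
    ⟨by rw [← List.append_assoc]; exact List.prefix_append _ _, List.suffix_append _ _⟩
  ext W
  constructor
  · rintro ⟨h1, h2, h3, -⟩
    exact hL.length_of_border_append_self h2 h3 (by omega)
  · rintro rfl
    refine ⟨by simp; ring, hB, by simp [hL.1], fun U hU hne => ?_⟩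
    by_contra! hlt
    have hUl := hU.length_lt hne
    refine hne (hL.length_of_border_append_self (hB.of_length_le hU hlt.le) ?_ ?_)
    · rintro rfl; omega
    · simp only [List.length_append] at hUl; omega

theorem BifixFree.maxBorderWords_append_self_eq_empty (hL : BifixFree L) {m : ℕ}
    (hm : m ≤ 4 * L.length) (hne : m ≠ 3 * L.length) : maxBorderWords (L ++ L) m = ∅ := by
  have hpos := hL.length_pos
  rw [Set.eq_empty_iff_forall_notMem]
  rintro W ⟨h1, h2, h3, h4⟩
  rcases Nat.lt_or_eq_of_le hm with hm | hm
  · have := hL.length_of_border_append_self h2 h3 (by omega)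
    apply hne
    rw [← h1, this]; simp; ring
  · obtain ⟨M, rfl⟩ := h2.exists_eq_append (by simp; omega)
    obtain rfl : M = [] := List.eq_nil_of_length_eq_zero (by simp at h1; omega)
    -- At length `4ℓ` the only candidate is `LLLL`, which has the longer border `LLL`.
    have := h4 (L ++ (L ++ L)) ⟨⟨L, by simp⟩, ⟨L, by simp⟩⟩ (by simp [hL.1])
    simp only [List.length_append] at this
    omega

/-! ### Instances of `Z₂` -/

theorem isInstance_zimin_two {W : List α} :
    IsInstance (zimin 2) W ↔ ∃ A B : List α, A ≠ [] ∧ B ≠ [] ∧ W = A ++ (B ++ A) := by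
  constructor
  · rintro ⟨φ, hφ, rfl⟩
    exact ⟨φ 0, φ 1, hφ 0, hφ 1, by simp [zimin]⟩
  · rintro ⟨A, B, hA, hB, rfl⟩
    refine ⟨fun x => if x = 0 then A else B, fun x => by dsimp only; split_ifs <;> assumption, ?_⟩
    simp [zimin]

/-- In a factorization `ABA` the border `A` has `L` as a border, hence `|A| ≥ |L|`; conversely `L`
itself can serve as `A`. -/
theorem BifixFree.isInstance_zimin_two_iff (hL : BifixFree L) {W : List α} (hLW : Border L W) :
    IsInstance (zimin 2) W ↔ 2 * L.length < W.length := by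
  rw [isInstance_zimin_two]
  constructor
  · rintro ⟨A, B, hA, hB, rfl⟩
    have := (hL.border hLW Border.append hA).length_le
    have := List.length_pos_of_ne_nil hB
    simp only [List.length_append]
    omega
  · intro h
    obtain ⟨M, rfl⟩ := hLW.exists_eq_append h.le
    refine ⟨L, M, hL.1, ?_, rfl⟩
    rintro rfl
    simp at h; omega

theorem BifixFree.instanceBifixFree_iff (hL : BifixFree L) {W : List α} (hLW : Border L W) :
    InstanceBifixFree (zimin 2) W ↔ ∀ U, Border U W → U ≠ W → U.length ≤ 2 * L.length := by
  constructor
  · intro h U hU hne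
    by_contra! hlt
    have h0 : U ≠ [] := by rintro rfl; simp at hlt
    exact h U ⟨h0, hne, hU⟩ ((hL.isInstance_zimin_two_iff (hL.border hLW hU h0)).2 hlt)
  · rintro h U ⟨h0, hne, hU⟩ hI
    have := (hL.isInstance_zimin_two_iff (hL.border hLW hU h0)).1 hI
    have := h U hU hne
    omega

/-- The words counted by `z2BifixFreeCount L n`. -/
def z2BifixFreeWords (L : List α) (n : ℕ) : Set (List α) :=
  {W | W.length = n ∧ IsInstance (zimin 2) W ∧ IsBifix L W ∧ InstanceBifixFree (zimin 2) W}

/-- A nonempty proper border other than `L` has length at least `2ℓ`, and at most `2ℓ` when there is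
no `Z₂`-bifix, so it can only be `LL`. -/
theorem BifixFree.z2BifixFreeWords_of_le (hL : BifixFree L) {n : ℕ} (hn : n ≤ 2 * L.length) :
    z2BifixFreeWords L n = ∅ := by
  rw [Set.eq_empty_iff_forall_notMem]
  rintro W ⟨h1, h2, h3, -⟩
  have := (hL.isInstance_zimin_two_iff h3.2.2).1 h2
  omega

theorem BifixFree.z2BifixFreeWords_eq (hL : BifixFree L) {n : ℕ} (hn : 2 * L.length < n) :
    z2BifixFreeWords L n = maxBorderWords L n ∪ maxBorderWords (L ++ L) n := by
  have hLL : (L ++ L).length = 2 * L.length := by simp; ring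
  ext W
  constructor
  · rintro ⟨h1, -, ⟨-, h3, h4⟩, h5⟩
    rw [hL.instanceBifixFree_iff h4] at h5
    by_cases hB : Border (L ++ L) W
    · exact Or.inr ⟨h1, hB, by rintro rfl; omega, by rwa [hLL]⟩
    · refine Or.inl ⟨h1, h4, h3, fun U hU hne => ?_⟩
      rcases eq_or_ne U [] with rfl | h0
      · simp
      have hLU := hL.border h4 hU h0
      rcases eq_or_ne L U with rfl | hLne
      · rfl
      · have := hLU.eq_append_self (le_antisymm (h5 U hU hne) (hL.two_mul_length_le hLU hLne))
        exact absurd (this ▸ hU) hB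
  · have key : ∀ W : List α, W.length = n → Border L W →
        (∀ U, Border U W → U ≠ W → U.length ≤ 2 * L.length) → W ∈ z2BifixFreeWords L n :=
      fun W h1 h2 h3 => ⟨h1, (hL.isInstance_zimin_two_iff h2).2 (by omega),
        ⟨hL.1, by rintro rfl; omega, h2⟩, (hL.instanceBifixFree_iff h2).2 h3⟩
    rintro (⟨h1, h2, h3, h4⟩ | ⟨h1, h2, h3, h4⟩)
    · exact key W h1 h2 fun U hU hne => (h4 U hU hne).trans (by omega)
    · exact key W h1 (Border.append_self.trans h2) fun U hU hne => (h4 U hU hne).trans hLL.le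

theorem BifixFree.ncard_z2BifixFreeWords [Fintype α] (hL : BifixFree L) {n : ℕ}
    (hn : 2 * L.length < n) :
    (z2BifixFreeWords L n).ncard =
      (maxBorderWords L n).ncard + (maxBorderWords (L ++ L) n).ncard := by
  rw [hL.z2BifixFreeWords_eq hn, Set.ncard_union_eq _ (finite_maxBorderWords n)
    (finite_maxBorderWords n)]
  rw [Set.disjoint_left]
  intro W hW hW'
  have h1 := hW.2.2.2 _ hW'.2.1 hW'.2.2.1
  have := hL.length_pos
  simp only [List.length_append] at h1
  omega

/-! ### The recursive sequences -/

theorem cSeq_of_le (q : ℕ) {ℓ n : ℕ} (h : n ≤ 2 * ℓ) : cSeq q ℓ n = 0 := by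
  rw [cSeq, dif_pos h]

theorem dSeq_of_le (q : ℕ) {ℓ n : ℕ} (h : n ≤ 4 * ℓ) : dSeq q ℓ n = 0 := by
  rw [dSeq, dif_pos h]

/-- The coefficients of the polynomial `r`. -/
def rCoeff (q ℓ n : ℕ) : ℤ :=
  q * (if n = 2 * ℓ + 1 then 1 else 0) - (if n = 4 * ℓ then 1 else 0) +
    (if n = 5 * ℓ then 1 else 0) - q * (if n = 5 * ℓ + 1 then 1 else 0) +
    (if n = 6 * ℓ then 1 else 0)

/-- The coefficients of the polynomial `u`. -/
def uCoeff (q ℓ n : ℕ) : ℤ :=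
  q * (if n = 4 * ℓ + 1 then 1 else 0) - (if n = 5 * ℓ then 1 else 0) +
    q * (if n = 5 * ℓ + 1 then 1 else 0) - (if n = 6 * ℓ then 1 else 0)

/-- One recursion for all cases: the parities of `ℓ` and `n` decide which halved terms survive, and
the exceptional clauses, including their collisions for `ℓ = 1`, are the coefficients of `r`. -/
theorem cSeq_succ (q : ℕ) {ℓ : ℕ} (hℓ : 1 ≤ ℓ) (n : ℕ) :
    cSeq q ℓ (n + 1) = q * cSeq q ℓ n - halve (cSeq q ℓ) (n + 1) -
      halve (cSeq q ℓ) (n + 1 + ℓ) + q * halve (cSeq q ℓ) (n + ℓ) + rCoeff q ℓ (n + 1) := by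
  have hz : ∀ m, m ≤ 2 * ℓ → cSeq q ℓ m = 0 := fun m hm => cSeq_of_le q hm
  rw [cSeq.eq_def q ℓ (n + 1)]
  generalize cSeq q ℓ = f at *
  unfold halve rCoeff
  by_cases h2 : ℓ = 1
  · subst h2
    obtain ⟨k, rfl | rfl⟩ := Nat.even_or_odd' n
    · simp only [show (2 * k + 1) / 2 = k by omega, show (2 * k + 1 + 1) / 2 = k + 1 by omega]
      grind
    · simp only [show (2 * k + 1 + 1) / 2 = k + 1 by omega,
        show (2 * k + 1 + 1 + 1) / 2 = k + 1 by omega]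
      grind
  · obtain ⟨a, rfl | rfl⟩ := Nat.even_or_odd' ℓ <;> obtain ⟨k, rfl | rfl⟩ := Nat.even_or_odd' n
    · simp only [
        show (2 * k + 1) / 2 = k by omega,
        show (2 * k + 1) % 2 = 1 by omega,
        show (2 * k + 1 + 2 * a) / 2 = k + a by omega,
        show (2 * k + 1 + 2 * a) % 2 = 1 by omega,
        show (2 * k + 2 * a) / 2 = k + a by omega,
        show (2 * k + 2 * a) % 2 = 0 by omega,
        show (2 * a) / 2 = a by omega,
        show (2 * a) % 2 = 0 by omega,
        show (5 * (2 * a)) / 2 = 5 * a by omega,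
        show (7 * (2 * a)) / 2 = 7 * a by omega,
        show 2 * k + 1 - 1 = 2 * k by omega]
      grind
    · simp only [
        show (2 * k + 1 + 1) / 2 = k + 1 by omega,
        show (2 * k + 1 + 1) % 2 = 0 by omega,
        show (2 * k + 1 + 1 + 2 * a) / 2 = k + a + 1 by omega,
        show (2 * k + 1 + 1 + 2 * a) % 2 = 0 by omega,
        show (2 * k + 1 + 2 * a) / 2 = k + a by omega,
        show (2 * k + 1 + 2 * a) % 2 = 1 by omega,
        show (2 * a) / 2 = a by omega,
        show (2 * a) % 2 = 0 by omega,
        show (5 * (2 * a)) / 2 = 5 * a by omega,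
        show (7 * (2 * a)) / 2 = 7 * a by omega,
        show 2 * k + 1 + 1 - 1 = 2 * k + 1 by omega]
      -- At the exceptional indices, arguments written in terms of `a` and of `k` denote the same
      -- numbers.
      have g1 : 2 * k + 2 = 8 * a → f (8 * a - 1) = f (2 * k + 1) ∧ f (5 * a) = f (k + a + 1) :=
        fun e => ⟨congrArg f (by omega), congrArg f (by omega)⟩
      have g2 : 2 * k + 2 = 10 * a → f (10 * a - 1) = f (2 * k + 1) ∧ f (6 * a) = f (k + a + 1) ∧
          f (5 * a) = f (k + 1) :=
        fun e => ⟨congrArg f (by omega), congrArg f (by omega), congrArg f (by omega)⟩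
      have g3 : 2 * k + 2 = 12 * a → f (12 * a - 1) = f (2 * k + 1) ∧ f (7 * a) = f (k + a + 1) ∧
          f (6 * a) = f (k + 1) :=
        fun e => ⟨congrArg f (by omega), congrArg f (by omega), congrArg f (by omega)⟩
      grind
    · simp only [
        show (2 * k + 1) / 2 = k by omega,
        show (2 * k + 1) % 2 = 1 by omega,
        show (2 * k + 1 + (2 * a + 1)) / 2 = k + a + 1 by omega,
        show (2 * k + 1 + (2 * a + 1)) % 2 = 0 by omega,
        show (2 * k + (2 * a + 1)) / 2 = k + a by omega,
        show (2 * k + (2 * a + 1)) % 2 = 1 by omega,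
        show (2 * a + 1) / 2 = a by omega,
        show (2 * a + 1) % 2 = 1 by omega,
        show (2 * a + 1 + 1) / 2 = a + 1 by omega,
        show (5 * (2 * a + 1)) / 2 = 5 * a + 2 by omega,
        show (7 * (2 * a + 1)) / 2 = 7 * a + 3 by omega,
        show (5 * (2 * a + 1) + 1) / 2 = 5 * a + 3 by omega,
        show 2 * k + 1 - 1 = 2 * k by omega]
      grind
    · simp only [
        show (2 * k + 1 + 1) / 2 = k + 1 by omega,
        show (2 * k + 1 + 1) % 2 = 0 by omega,
        show (2 * k + 1 + 1 + (2 * a + 1)) / 2 = k + a + 1 by omega,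
        show (2 * k + 1 + 1 + (2 * a + 1)) % 2 = 1 by omega,
        show (2 * k + 1 + (2 * a + 1)) / 2 = k + a + 1 by omega,
        show (2 * k + 1 + (2 * a + 1)) % 2 = 0 by omega,
        show (2 * a + 1) / 2 = a by omega,
        show (2 * a + 1) % 2 = 1 by omega,
        show (2 * a + 1 + 1) / 2 = a + 1 by omega,
        show (5 * (2 * a + 1)) / 2 = 5 * a + 2 by omega,
        show (7 * (2 * a + 1)) / 2 = 7 * a + 3 by omega,
        show (5 * (2 * a + 1) + 1) / 2 = 5 * a + 3 by omega,
        show 2 * k + 1 + 1 - 1 = 2 * k + 1 by omega]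
      grind

theorem dSeq_succ (q : ℕ) {ℓ : ℕ} (hℓ : 1 ≤ ℓ) (n : ℕ) :
    dSeq q ℓ (n + 1) = q * dSeq q ℓ n - halve (dSeq q ℓ) (n + 1) -
      halve (dSeq q ℓ) (n + 1 + ℓ) + q * halve (dSeq q ℓ) (n + ℓ) -
      halve (dSeq q ℓ) (n + 1 + 2 * ℓ) + q * halve (dSeq q ℓ) (n + 2 * ℓ) +
      uCoeff q ℓ (n + 1) := by
  have hz : ∀ m, m ≤ 4 * ℓ → dSeq q ℓ m = 0 := fun m hm => dSeq_of_le q hm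
  rw [dSeq.eq_def q ℓ (n + 1)]
  generalize dSeq q ℓ = f at *
  unfold halve uCoeff
  by_cases h2 : ℓ = 1
  · subst h2
    obtain ⟨k, rfl | rfl⟩ := Nat.even_or_odd' n
    · simp only [show (2 * k + 1) / 2 = k by omega, show (2 * k + 1 + 1) / 2 = k + 1 by omega]
      grind
    · simp only [show (2 * k + 1 + 1) / 2 = k + 1 by omega,
        show (2 * k + 1 + 1 + 1) / 2 = k + 1 by omega]
      grind
  · obtain ⟨a, rfl | rfl⟩ := Nat.even_or_odd' ℓ <;> obtain ⟨k, rfl | rfl⟩ := Nat.even_or_odd' n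
    · simp only [
        show (2 * k + 1) / 2 = k by omega,
        show (2 * k + 1) % 2 = 1 by omega,
        show (2 * k + 1 + 2 * a) / 2 = k + a by omega,
        show (2 * k + 1 + 2 * a) % 2 = 1 by omega,
        show (2 * k + 2 * a) / 2 = k + a by omega,
        show (2 * k + 2 * a) % 2 = 0 by omega,
        show (2 * k + 1 + 2 * (2 * a)) / 2 = k + 2 * a by omega,
        show (2 * k + 1 + 2 * (2 * a)) % 2 = 1 by omega,
        show (2 * k + 2 * (2 * a)) / 2 = k + 2 * a by omega,
        show (2 * k + 2 * (2 * a)) % 2 = 0 by omega,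
        show (2 * a) / 2 = a by omega,
        show (2 * a) % 2 = 0 by omega,
        show 2 * k + 1 - 1 = 2 * k by omega]
      grind
    · simp only [
        show (2 * k + 1 + 1) / 2 = k + 1 by omega,
        show (2 * k + 1 + 1) % 2 = 0 by omega,
        show (2 * k + 1 + 1 + 2 * a) / 2 = k + a + 1 by omega,
        show (2 * k + 1 + 1 + 2 * a) % 2 = 0 by omega,
        show (2 * k + 1 + 2 * a) / 2 = k + a by omega,
        show (2 * k + 1 + 2 * a) % 2 = 1 by omega,
        show (2 * k + 1 + 1 + 2 * (2 * a)) / 2 = k + 2 * a + 1 by omega,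
        show (2 * k + 1 + 1 + 2 * (2 * a)) % 2 = 0 by omega,
        show (2 * k + 1 + 2 * (2 * a)) / 2 = k + 2 * a by omega,
        show (2 * k + 1 + 2 * (2 * a)) % 2 = 1 by omega,
        show (2 * a) / 2 = a by omega,
        show (2 * a) % 2 = 0 by omega,
        show 2 * k + 1 + 1 - 1 = 2 * k + 1 by omega]
      grind
    · simp only [
        show (2 * k + 1) / 2 = k by omega,
        show (2 * k + 1) % 2 = 1 by omega,
        show (2 * k + 1 + (2 * a + 1)) / 2 = k + a + 1 by omega,
        show (2 * k + 1 + (2 * a + 1)) % 2 = 0 by omega,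
        show (2 * k + (2 * a + 1)) / 2 = k + a by omega,
        show (2 * k + (2 * a + 1)) % 2 = 1 by omega,
        show (2 * k + 1 + 2 * (2 * a + 1)) / 2 = k + 2 * a + 1 by omega,
        show (2 * k + 1 + 2 * (2 * a + 1)) % 2 = 1 by omega,
        show (2 * k + 2 * (2 * a + 1)) / 2 = k + 2 * a + 1 by omega,
        show (2 * k + 2 * (2 * a + 1)) % 2 = 0 by omega,
        show (2 * a + 1) / 2 = a by omega,
        show (2 * a + 1) % 2 = 1 by omega,
        show (2 * a + 1 + 1) / 2 = a + 1 by omega,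
        show 2 * k + 1 - 1 = 2 * k by omega]
      grind
    · simp only [
        show (2 * k + 1 + 1) / 2 = k + 1 by omega,
        show (2 * k + 1 + 1) % 2 = 0 by omega,
        show (2 * k + 1 + 1 + (2 * a + 1)) / 2 = k + a + 1 by omega,
        show (2 * k + 1 + 1 + (2 * a + 1)) % 2 = 1 by omega,
        show (2 * k + 1 + (2 * a + 1)) / 2 = k + a + 1 by omega,
        show (2 * k + 1 + (2 * a + 1)) % 2 = 0 by omega,
        show (2 * k + 1 + 1 + 2 * (2 * a + 1)) / 2 = k + 2 * a + 2 by omega,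
        show (2 * k + 1 + 1 + 2 * (2 * a + 1)) % 2 = 0 by omega,
        show (2 * k + 1 + 2 * (2 * a + 1)) / 2 = k + 2 * a + 1 by omega,
        show (2 * k + 1 + 2 * (2 * a + 1)) % 2 = 1 by omega,
        show (2 * a + 1) / 2 = a by omega,
        show (2 * a + 1) % 2 = 1 by omega,
        show (2 * a + 1 + 1) / 2 = a + 1 by omega,
        show 2 * k + 1 + 1 - 1 = 2 * k + 1 by omega]
      grind

/-! ### The counts satisfy the recursions -/

theorem halve_congr {R : Type*} [Zero R] {f g : ℕ → R} {n m : ℕ} (h : ∀ k ≤ n, f k = g k)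
    (hm : m ≤ 2 * n + 1) : halve f m = halve g m := by
  unfold halve
  rw [h (m / 2) (by omega)]

theorem halve_indicator (m n : ℕ) :
    halve (fun k => if k = m then (1 : ℤ) else 0) n = if n = 2 * m then 1 else 0 := by
  unfold halve
  dsimp only
  split_ifs <;> omega

theorem halve_add (f g : ℕ → ℤ) (n : ℕ) :
    halve (fun k => f k + g k) n = halve f n + halve g n := by
  unfold halve
  split_ifs <;> simp

theorem halve_sub (f g : ℕ → ℤ) (n : ℕ) :
    halve (fun k => f k - g k) n = halve f n - halve g n := by
  unfold halve
  split_ifs <;> simp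

theorem halve_natCast (f : ℕ → ℕ) (n : ℕ) :
    ((halve f n : ℕ) : ℤ) = halve (fun k => (f k : ℤ)) n := by
  unfold halve
  split_ifs <;> simp

/-- The corrections are single words: `LL` is not a `Z₂`-instance, so it is absent from `c`, while
`LLL` has longest border `LL` but is credited to `c` rather than `d`. -/
theorem BifixFree.ncard_maxBorderWords_eq [Fintype α] (hL : BifixFree L) (n : ℕ) :
    ((maxBorderWords L n).ncard : ℤ) = cSeq (Fintype.card α) L.length n +
      (if n = 2 * L.length then 1 else 0) - (if n = 3 * L.length then 1 else 0) := by
  have hpos := hL.length_pos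
  induction n using Nat.strong_induction_on with
  | _ n ih =>
    rcases lt_trichotomy n (2 * L.length) with hn | rfl | hn
    · rw [hL.maxBorderWords_of_lt hn, cSeq_of_le _ hn.le, if_neg (by omega), if_neg (by omega)]
      simp
    · rw [hL.maxBorderWords_two_mul, cSeq_of_le _ le_rfl, if_pos rfl, if_neg (by omega)]
      simp
    · obtain ⟨n, rfl⟩ : ∃ m, n = m + 1 := ⟨n - 1, by omega⟩
      have h1 := congrArg (fun x : ℕ => (x : ℤ)) (hL.ncard_maxBorderWords_succ (n := n) (by omega))
      simp only [Nat.cast_add, Nat.cast_mul, halve_natCast] at h1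
      have ih' := fun k (hk : k ≤ n) => ih k (by omega)
      rw [halve_congr ih' (m := n + 1 + L.length) (by omega),
        halve_congr ih' (m := n + L.length) (by omega),
        halve_congr ih' (m := n + 1) (by omega), ih n (by omega)] at h1
      simp only [halve_sub, halve_add, halve_indicator] at h1
      rw [cSeq_succ _ hpos]
      unfold rCoeff
      -- Positions of the two corrections after shifting and halving. Those at `n = 3ℓ` and at `n +
      -- 1 = 3ℓ` cancel; the others make up `rCoeff`.
      simp only [show n + L.length = 2 * (2 * L.length) ↔ n = 3 * L.length by omega,
        show n + L.length = 2 * (3 * L.length) ↔ n + 1 = 5 * L.length + 1 by omega,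
        show n + 1 + L.length = 2 * (2 * L.length) ↔ n + 1 = 3 * L.length by omega,
        show n + 1 + L.length = 2 * (3 * L.length) ↔ n + 1 = 5 * L.length by omega,
        show n + 1 = 2 * (2 * L.length) ↔ n + 1 = 4 * L.length by omega,
        show n + 1 = 2 * (3 * L.length) ↔ n + 1 = 6 * L.length by omega,
        show n = 2 * L.length ↔ n + 1 = 2 * L.length + 1 by omega] at h1
      rw [if_neg (show ¬ n + 1 = 2 * L.length by omega)]
      linear_combination h1

theorem BifixFree.ncard_maxBorderWords_append_self_eq [Fintype α] (hL : BifixFree L) (n : ℕ) :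
    ((maxBorderWords (L ++ L) n).ncard : ℤ) = dSeq (Fintype.card α) L.length n +
      (if n = 3 * L.length then 1 else 0) := by
  have hpos := hL.length_pos
  induction n using Nat.strong_induction_on with
  | _ n ih =>
    by_cases hn : n ≤ 4 * L.length
    · rw [dSeq_of_le _ hn]
      split_ifs with h
      · rw [h, hL.maxBorderWords_append_self_three_mul]; simp
      · rw [hL.maxBorderWords_append_self_eq_empty hn h]; simp
    · obtain ⟨n, rfl⟩ : ∃ m, n = m + 1 := ⟨n - 1, by omega⟩
      have h1 := congrArg (fun x : ℕ => (x : ℤ))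
        (hL.ncard_maxBorderWords_append_self_succ (n := n) (by omega))
      simp only [Nat.cast_add, Nat.cast_mul, halve_natCast] at h1
      have ih' := fun k (hk : k ≤ n) => ih k (by omega)
      rw [halve_congr ih' (m := n + 1 + L.length) (by omega),
        halve_congr ih' (m := n + L.length) (by omega),
        halve_congr ih' (m := n + 1 + 2 * L.length) (by omega),
        halve_congr ih' (m := n + 2 * L.length) (by omega),
        halve_congr ih' (m := n + 1) (by omega), ih n (by omega)] at h1
      simp only [halve_add, halve_indicator] at h1
      rw [dSeq_succ _ hpos]
      unfold uCoeff
      simp only [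
        show n + L.length = 2 * (3 * L.length) ↔ n + 1 = 5 * L.length + 1 by omega,
        show n + 1 + L.length = 2 * (3 * L.length) ↔ n + 1 = 5 * L.length by omega,
        show n + 2 * L.length = 2 * (3 * L.length) ↔ n + 1 = 4 * L.length + 1 by omega,
        show n + 1 = 2 * (3 * L.length) ↔ n + 1 = 6 * L.length by omega] at h1
      rw [if_neg (show ¬ n + 1 + 2 * L.length = 2 * (3 * L.length) by omega),
        if_neg (show ¬ n = 3 * L.length by omega)] at h1
      rw [if_neg (show ¬ n + 1 = 3 * L.length by omega)]
      linear_combination h1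

theorem BifixFree.z2BifixFreeCount_eq {q : ℕ} {L : List (Fin q)} (hL : BifixFree L) (n : ℕ) :
    (z2BifixFreeCount L n : ℤ) = cSeq q L.length n + dSeq q L.length n := by
  change ((z2BifixFreeWords L n).ncard : ℤ) = _
  rcases le_or_gt n (2 * L.length) with hn | hn
  · rw [hL.z2BifixFreeWords_of_le hn, cSeq_of_le q hn, dSeq_of_le q (by omega)]
    simp
  · have h1 := hL.ncard_maxBorderWords_eq n
    have h2 := hL.ncard_maxBorderWords_append_self_eq n
    rw [Fintype.card_fin] at h1 h2
    rw [hL.ncard_z2BifixFreeWords hn, Nat.cast_add, h1, h2, if_neg (by omega)]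
    ring

/-- Over an alphabet with two letters there are bifix-free words of every positive length. -/
theorem exists_bifixFree {a b : α} (hab : a ≠ b) (n : ℕ) :
    BifixFree (a :: List.replicate n b) := by
  refine ⟨by simp, ?_⟩
  rintro U ⟨h0, hne, h1, h2⟩
  rcases List.suffix_cons_iff.1 h2 with rfl | h2
  · exact hne rfl
  · cases U with
    | nil => exact h0 rfl
    | cons c U =>
      obtain ⟨t, ht⟩ := h1
      have hc := List.eq_of_mem_replicate (h2.subset (List.mem_cons_self (a := c)))
      exact hab ((List.cons.inj ht).1.symm.trans hc)

/-- The signs in the recursion hide the growth rate. It is read off from the trivial bound on the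
count for one bifix-free word of length `ℓ`. -/
theorem abs_cSeq_le {q ℓ : ℕ} (hq : 2 ≤ q) (hℓ : 1 ≤ ℓ) (n : ℕ) :
    |cSeq q ℓ n| ≤ (q : ℤ) ^ n + 1 := by
  obtain ⟨k, rfl⟩ : ∃ k, ℓ = k + 1 := ⟨ℓ - 1, by omega⟩
  set L : List (Fin q) := ⟨0, by omega⟩ :: List.replicate k ⟨1, by omega⟩
  have hL : BifixFree L := exists_bifixFree (by simp) k
  have h1 := hL.ncard_maxBorderWords_eq n
  have h2 := ncard_maxBorderWords_le (K := L) n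
  rw [Fintype.card_fin] at h1 h2
  rw [show L.length = k + 1 by simp [L]] at h1
  zify at h2
  rw [abs_le]
  constructor <;> split_ifs at h1 <;> omega

theorem abs_dSeq_le {q ℓ : ℕ} (hq : 2 ≤ q) (hℓ : 1 ≤ ℓ) (n : ℕ) :
    |dSeq q ℓ n| ≤ (q : ℤ) ^ n + 1 := by
  obtain ⟨k, rfl⟩ : ∃ k, ℓ = k + 1 := ⟨ℓ - 1, by omega⟩
  set L : List (Fin q) := ⟨0, by omega⟩ :: List.replicate k ⟨1, by omega⟩
  have hL : BifixFree L := exists_bifixFree (by simp) k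
  have h1 := hL.ncard_maxBorderWords_append_self_eq n
  have h2 := ncard_maxBorderWords_le (K := L ++ L) n
  rw [Fintype.card_fin] at h1 h2
  rw [show L.length = k + 1 by simp [L]] at h1
  zify at h2
  rw [abs_le]
  constructor <;> split_ifs at h1 <;> omega

/-! ### Generating functions -/

section genFun

variable {f : ℕ → ℝ} {x : ℝ}

theorem hasSum_succ_mul_pow {a : ℝ} (h : HasSum (fun n => f n * x ^ n) a) (h0 : f 0 = 0) :
    HasSum (fun n => f (n + 1) * x ^ (n + 1)) a := by
  have := (hasSum_nat_add_iff' 1).2 h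
  simpa [h0] using this

theorem hasSum_halve_mul_pow {a : ℝ} (h : HasSum (fun n => f n * (x ^ 2) ^ n) a) :
    HasSum (fun n => halve f n * x ^ n) a := by
  have hinj : Function.Injective fun n : ℕ => 2 * n := fun m n e => by dsimp only at e; omega
  rw [← hinj.hasSum_iff]
  · convert h using 2 with n
    simp only [Function.comp, halve_two_mul, pow_mul]
  · intro n hn
    rw [halve_odd, zero_mul]
    by_contra hpar
    exact hn ⟨n / 2, by dsimp only; omega⟩

/-- The terms lost in the shift vanish, so shifting by `j` is division by `x ^ j`; this creates the
negative powers in `s` and `v`. -/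
theorem hasSum_halve_add_mul_pow {a : ℝ} (hx : x ≠ 0) {j : ℕ} (hj : ∀ m ≤ j, f m = 0)
    (h : HasSum (fun n => f n * (x ^ 2) ^ n) a) :
    HasSum (fun n => halve f (n + j) * x ^ n) (x ^ (-(j : ℤ)) * a) := by
  have h1 := (hasSum_nat_add_iff' j).2 (hasSum_halve_mul_pow h)
  rw [Finset.sum_eq_zero, sub_zero] at h1
  · refine (h1.mul_left (x ^ (-(j : ℤ)))).congr_fun fun n => ?_
    rw [pow_add, zpow_neg, zpow_natCast]
    field_simp
  · intro i hi
    have := Finset.mem_range.1 hi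
    unfold halve
    rw [hj _ (by omega)]
    simp

theorem hasSum_indicator_mul_pow {m : ℕ} (hm : 1 ≤ m) (x : ℝ) :
    HasSum (fun n : ℕ => (if n + 1 = m then (1 : ℝ) else 0) * x ^ (n + 1)) (x ^ m) := by
  obtain ⟨k, rfl⟩ : ∃ k, m = k + 1 := ⟨m - 1, by omega⟩
  have := hasSum_ite_eq k (x ^ (k + 1))
  convert this using 2 with n
  by_cases h : n = k
  · simp [h]
  · rw [if_neg (by omega), if_neg h, zero_mul]

variable {q : ℕ}

theorem abs_mul_pow_le {N : ℕ} (hf : ∀ n, |f n| ≤ (q : ℝ) ^ n + 1) (hN : ∀ n < N, f n = 0)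
    (hq : 1 ≤ q) (hx : 0 ≤ x) (hqx : q * x ≤ 1 / 2) (n : ℕ) :
    ‖f n * x ^ n‖ ≤ 2 * (2 * q * x) ^ N * (1 / 2) ^ n := by
  have hqx0 : 0 ≤ (q : ℝ) * x := by positivity
  rw [Real.norm_eq_abs, abs_mul, abs_of_nonneg (pow_nonneg hx n)]
  rcases lt_or_ge n N with hn | hn
  · rw [hN n hn, abs_zero, zero_mul]
    positivity
  · have h1 : |f n| ≤ 2 * (q : ℝ) ^ n := by
      have : (1 : ℝ) ≤ (q : ℝ) ^ n := one_le_pow₀ (by exact_mod_cast hq)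
      linarith [hf n]
    obtain ⟨k, rfl⟩ := Nat.exists_eq_add_of_le hn
    calc |f (N + k)| * x ^ (N + k) ≤ 2 * (q : ℝ) ^ (N + k) * x ^ (N + k) := by gcongr
      _ = 2 * (q * x) ^ N * (q * x) ^ k := by rw [mul_assoc, ← mul_pow, pow_add, mul_assoc]
      _ ≤ 2 * (q * x) ^ N * (1 / 2) ^ k := by gcongr
      _ = 2 * (2 * q * x) ^ N * (1 / 2) ^ (N + k) := by
        rw [mul_assoc (2 : ℝ) (q : ℝ) x, mul_pow (2 : ℝ) ((q : ℝ) * x), pow_add, one_div, inv_pow,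
          inv_pow]
        field_simp

theorem summable_mul_pow (hf : ∀ n, |f n| ≤ (q : ℝ) ^ n + 1) (hq : 1 ≤ q) (hx : 0 ≤ x)
    (hqx : q * x ≤ 1 / 2) : Summable fun n => f n * x ^ n := by
  refine Summable.of_norm_bounded (summable_geometric_two.mul_left (2 * (2 * q * x) ^ 0))
    (abs_mul_pow_le hf (by simp) hq hx hqx)

theorem abs_tsum_mul_pow_le {N : ℕ} (hf : ∀ n, |f n| ≤ (q : ℝ) ^ n + 1) (hN : ∀ n < N, f n = 0)
    (hq : 1 ≤ q) (hx : 0 ≤ x) (hqx : q * x ≤ 1 / 2) :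
    |∑' n, f n * x ^ n| ≤ 4 * (2 * q) ^ N * x ^ N := by
  have := tsum_of_norm_bounded (hasSum_geometric_two.mul_left (2 * (2 * q * x) ^ N))
    (abs_mul_pow_le hf hN hq hx hqx)
  rw [Real.norm_eq_abs] at this
  refine this.trans_eq ?_
  rw [mul_pow (2 * (q : ℝ)) x]; ring

end genFun

/-! ### Functional equations of the generating functions -/

theorem halve_intCast (f : ℕ → ℤ) (n : ℕ) :
    ((halve f n : ℤ) : ℝ) = halve (fun k => (f k : ℝ)) n := by
  unfold halve
  split_ifs <;> simp

/-- The generating function of `cSeq q ℓ`. -/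
noncomputable def cGen (q ℓ : ℕ) (x : ℝ) : ℝ := ∑' n, (cSeq q ℓ n : ℝ) * x ^ n

/-- The generating function of `dSeq q ℓ`. -/
noncomputable def dGen (q ℓ : ℕ) (x : ℝ) : ℝ := ∑' n, (dSeq q ℓ n : ℝ) * x ^ n

section

variable {q ℓ : ℕ}

theorem abs_cSeq_cast_le (hq : 2 ≤ q) (hℓ : 1 ≤ ℓ) (n : ℕ) :
    |(cSeq q ℓ n : ℝ)| ≤ (q : ℝ) ^ n + 1 := by
  exact_mod_cast abs_cSeq_le hq hℓ n

theorem abs_dSeq_cast_le (hq : 2 ≤ q) (hℓ : 1 ≤ ℓ) (n : ℕ) :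
    |(dSeq q ℓ n : ℝ)| ≤ (q : ℝ) ^ n + 1 := by
  exact_mod_cast abs_dSeq_le hq hℓ n

theorem mul_sq_le_half (hq : 2 ≤ q) {x : ℝ} (hx : 0 ≤ x) (hqx : q * x ≤ 1 / 2) :
    q * x ^ 2 ≤ 1 / 2 := by
  have : (2 : ℝ) ≤ q := by exact_mod_cast hq
  nlinarith

theorem cGen_functional (hq : 2 ≤ q) (hℓ : 1 ≤ ℓ) {x : ℝ} (hx : 0 < x) (hqx : q * x ≤ 1 / 2) :
    (1 - q * x) * cGen q ℓ x = rPoly q ℓ x - sPoly q ℓ x * cGen q ℓ (x ^ 2) := by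
  have hz : ∀ m ≤ 2 * ℓ, (cSeq q ℓ m : ℝ) = 0 := fun m hm => by rw [cSeq_of_le q hm]; simp
  have hF : HasSum (fun n => (cSeq q ℓ n : ℝ) * x ^ n) (cGen q ℓ x) :=
    (summable_mul_pow (abs_cSeq_cast_le hq hℓ) (by omega) hx.le hqx).hasSum
  have hF2 : HasSum (fun n => (cSeq q ℓ n : ℝ) * (x ^ 2) ^ n) (cGen q ℓ (x ^ 2)) :=
    (summable_mul_pow (abs_cSeq_cast_le hq hℓ) (by omega) (by positivity)
      (mul_sq_le_half hq hx.le hqx)).hasSum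
  have hH : ∀ j ≤ ℓ, HasSum (fun n => halve (fun k => (cSeq q ℓ k : ℝ)) (n + j) * x ^ n)
      (x ^ (-(j : ℤ)) * cGen q ℓ (x ^ 2)) := fun j hj =>
    hasSum_halve_add_mul_pow hx.ne' (fun m hm => hz m (by omega)) hF2
  have hH0 : ∀ j ≤ ℓ, halve (fun k => (cSeq q ℓ k : ℝ)) (0 + j) = 0 := fun j hj => by
    unfold halve; dsimp only; rw [hz _ (by omega), ite_self]
  have hI := fun m (hm : 1 ≤ m) => hasSum_indicator_mul_pow hm x
  have hL := hasSum_succ_mul_pow hF (hz 0 (by omega))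
  have hR := (((((hF.mul_left (q * x)).sub (hasSum_succ_mul_pow (hH 0 (by omega))
    (hH0 0 (by omega)))).sub (hasSum_succ_mul_pow (hH ℓ le_rfl) (hH0 ℓ le_rfl))).add
    ((hH ℓ le_rfl).mul_left (q * x)))).add
    ((((((hI (2 * ℓ + 1) (by omega)).mul_left (q : ℝ)).sub (hI (4 * ℓ) (by omega))).add
      (hI (5 * ℓ) (by omega))).sub ((hI (5 * ℓ + 1) (by omega)).mul_left (q : ℝ))).add
      (hI (6 * ℓ) (by omega)))
  have key := hL.unique (hR.congr_fun ?_)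
  · unfold rPoly sPoly
    rw [sub_eq_add_neg (1 : ℤ), zpow_add₀ hx.ne', zpow_one]
    rw [Nat.cast_zero, neg_zero, zpow_zero] at key
    linear_combination key
  · intro n
    rw [cSeq_succ q hℓ n]
    unfold rCoeff
    push_cast [halve_intCast]
    ring

theorem dGen_functional (hq : 2 ≤ q) (hℓ : 1 ≤ ℓ) {x : ℝ} (hx : 0 < x) (hqx : q * x ≤ 1 / 2) :
    (1 - q * x) * dGen q ℓ x = uPoly q ℓ x - vPoly q ℓ x * dGen q ℓ (x ^ 2) := by
  have hz : ∀ m ≤ 4 * ℓ, (dSeq q ℓ m : ℝ) = 0 := fun m hm => by rw [dSeq_of_le q hm]; simp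
  have hF : HasSum (fun n => (dSeq q ℓ n : ℝ) * x ^ n) (dGen q ℓ x) :=
    (summable_mul_pow (abs_dSeq_cast_le hq hℓ) (by omega) hx.le hqx).hasSum
  have hF2 : HasSum (fun n => (dSeq q ℓ n : ℝ) * (x ^ 2) ^ n) (dGen q ℓ (x ^ 2)) :=
    (summable_mul_pow (abs_dSeq_cast_le hq hℓ) (by omega) (by positivity)
      (mul_sq_le_half hq hx.le hqx)).hasSum
  have hH : ∀ j ≤ 2 * ℓ, HasSum (fun n => halve (fun k => (dSeq q ℓ k : ℝ)) (n + j) * x ^ n)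
      (x ^ (-(j : ℤ)) * dGen q ℓ (x ^ 2)) := fun j hj =>
    hasSum_halve_add_mul_pow hx.ne' (fun m hm => hz m (by omega)) hF2
  have hH0 : ∀ j ≤ 2 * ℓ, halve (fun k => (dSeq q ℓ k : ℝ)) (0 + j) = 0 := fun j hj => by
    unfold halve; dsimp only; rw [hz _ (by omega), ite_self]
  have hI := fun m (hm : 1 ≤ m) => hasSum_indicator_mul_pow hm x
  have hL := hasSum_succ_mul_pow hF (hz 0 (by omega))
  have hS := fun j (hj : j ≤ 2 * ℓ) => hasSum_succ_mul_pow (hH j hj) (hH0 j hj)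
  have hR := ((((((hF.mul_left (q * x)).sub (hS 0 (by omega))).sub (hS ℓ (by omega))).add
    ((hH ℓ (by omega)).mul_left (q * x))).sub (hS (2 * ℓ) le_rfl)).add
    ((hH (2 * ℓ) le_rfl).mul_left (q * x))).add
    (((((hI (4 * ℓ + 1) (by omega)).mul_left (q : ℝ)).sub (hI (5 * ℓ) (by omega))).add
      ((hI (5 * ℓ + 1) (by omega)).mul_left (q : ℝ))).sub (hI (6 * ℓ) (by omega)))
  have key := hL.unique (hR.congr_fun ?_)
  · unfold uPoly vPoly
    rw [sub_eq_add_neg (1 : ℤ), sub_eq_add_neg (1 : ℤ), zpow_add₀ hx.ne', zpow_add₀ hx.ne',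
      zpow_one]
    rw [Nat.cast_zero, neg_zero, zpow_zero] at key
    push_cast at key
    linear_combination key
  · intro n
    rw [dSeq_succ q hℓ n]
    unfold uCoeff
    push_cast [halve_intCast]
    ring

end

/-! ### Iterating the functional equation -/

theorem hasSum_of_telescope {a t : ℕ → ℝ} (ha : Summable a) (h : ∀ i, t i = a i - a (i + 1)) :
    HasSum t (a 0) := by
  have h1 := ha.hasSum
  have h2 := h1.sub ((hasSum_nat_add_iff' 1).2 h1)
  simp only [Finset.range_one, Finset.sum_singleton, sub_sub_cancel] at h2
  rwa [funext h]

section node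

variable {q : ℕ}

theorem node_eq (q i : ℕ) : node q i = ((q : ℝ)⁻¹) ^ 2 ^ (i + 1) := by
  unfold node
  rw [zpow_neg, inv_pow, ← zpow_natCast]
  norm_num

theorem node_succ (q i : ℕ) : node q (i + 1) = node q i ^ 2 := by
  rw [node_eq, node_eq, ← pow_mul, pow_succ 2 (i + 1)]

theorem node_pos (hq : 2 ≤ q) (i : ℕ) : 0 < node q i := by
  have : (0 : ℝ) < q := by exact_mod_cast (by omega : 0 < q)
  rw [node_eq]
  positivity

theorem mul_node_eq (hq : 2 ≤ q) (i : ℕ) :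
    (q : ℝ) * node q i = (q : ℝ) ^ (1 - (2 : ℤ) ^ (i + 1)) := by
  have : (q : ℝ) ≠ 0 := by exact_mod_cast (by omega : q ≠ 0)
  unfold node
  rw [sub_eq_add_neg, zpow_add₀ this, zpow_one]

theorem inv_cast_le_half (hq : 2 ≤ q) : (q : ℝ)⁻¹ ≤ 1 / 2 := by
  have : (2 : ℝ) ≤ q := by exact_mod_cast hq
  rw [one_div]
  gcongr

theorem node_le (hq : 2 ≤ q) (i : ℕ) : node q i ≤ (1 / 2) ^ 2 ^ (i + 1) := by
  rw [node_eq]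
  gcongr
  exact inv_cast_le_half hq

theorem mul_node_le (hq : 2 ≤ q) (i : ℕ) : (q : ℝ) * node q i ≤ 1 / 2 := by
  have h0 : (0 : ℝ) < q := by exact_mod_cast (by omega : 0 < q)
  have h1 := inv_cast_le_half hq
  have h2 : node q i ≤ (q : ℝ)⁻¹ ^ 2 := by
    rw [node_eq]
    refine pow_le_pow_of_le_one (by positivity) (by linarith) ?_
    exact le_self_pow₀ (by norm_num) (by omega)
  calc (q : ℝ) * node q i ≤ q * (q : ℝ)⁻¹ ^ 2 := by gcongr
    _ = (q : ℝ)⁻¹ := by field_simp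
    _ ≤ 1 / 2 := h1

end node

/-- If `(1 - q x) F(x) = r(x) - s(x) F(x²)`, then `F(q⁻²)` is the sum of the series obtained by
iterating this equation, provided that `F` vanishes at `0` to an order that compensates the pole
of `s`. -/
theorem hasSum_iterate {q N : ℕ} (hq : 2 ≤ q) {F r s : ℝ → ℝ} {C : ℝ}
    (hfun : ∀ x : ℝ, 0 < x → q * x ≤ 1 / 2 → (1 - q * x) * F x = r x - s x * F (x ^ 2))
    (hF : ∀ x : ℝ, 0 < x → q * x ≤ 1 / 2 → |F x| ≤ C * x ^ N)
    (hs : ∀ x : ℝ, 0 < x → q * x ≤ 1 / 2 → |s x| * x ^ N ≤ 5 * x) :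
    HasSum (fun i => (-1) ^ i * r (node q i) * (∏ j ∈ Finset.range i, s (node q j)) / denom q i)
      (F (node q 0)) := by
  set D : ℕ → ℝ := fun i => ∏ k ∈ Finset.range i, (1 - (q : ℝ) * node q k) with hD
  have hD1 : ∀ i, 1 / 2 ≤ 1 - (q : ℝ) * node q i := fun i => by linarith [mul_node_le hq i]
  have hDpos : ∀ i, 0 < D i := fun i => Finset.prod_pos fun k _ => by linarith [hD1 k]
  have hden : ∀ i, denom q i = D (i + 1) := fun i => by
    simp only [denom, hD, mul_node_eq hq]
  -- `p i` is the coefficient of `F (node q i)` after `i` substitutions of the functional equation.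
  set p : ℕ → ℝ := fun i => (-1) ^ i * (∏ j ∈ Finset.range i, s (node q j)) / D i with hp
  have hp1 : ∀ i, p (i + 1) = -(p i * s (node q i) / (1 - q * node q i)) := fun i => by
    simp only [hp, hD, Finset.prod_range_succ, pow_succ]
    field_simp
  set w : ℕ → ℝ := fun i => |p i| * node q i ^ N with hw
  have hws : Summable w := by
    refine summable_of_ratio_norm_eventually_le (r := 10 / 16) (by norm_num) ?_
    -- For `i ≥ 1` the node is at most `1/16`, so the ratio is at most `5 · (1/16) / (1/2) = 10/16`.
    -- At `i = 0` the node can be `1/4`, which is too large.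
    filter_upwards [eventually_ge_atTop 1] with i hi
    have hn := node_pos hq i
    have hwn : ∀ i, 0 ≤ w i := fun i => mul_nonneg (abs_nonneg _) (pow_nonneg (node_pos hq i).le _)
    rw [Real.norm_of_nonneg (hwn _), Real.norm_of_nonneg (hwn _)]
    have h16 : node q i ≤ 1 / 16 := by
      refine (node_le hq i).trans ?_
      calc (1 / 2 : ℝ) ^ 2 ^ (i + 1) ≤ (1 / 2) ^ 2 ^ (1 + 1) := by
            refine pow_le_pow_of_le_one (by norm_num) (by norm_num) ?_
            exact Nat.pow_le_pow_right (by norm_num) (by omega)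
        _ = 1 / 16 := by norm_num
    have hpos : 0 < 1 - (q : ℝ) * node q i := by linarith [hD1 i]
    calc w (i + 1) = w i * (|s (node q i)| * node q i ^ N / (1 - q * node q i)) := by
          simp only [hw, hp1, abs_neg, abs_div, abs_mul, abs_of_pos hpos, node_succ]
          ring
      _ ≤ w i * (10 / 16) := by
          refine mul_le_mul_of_nonneg_left ?_ (hwn i)
          rw [div_le_iff₀ hpos]
          have := hs _ hn (mul_node_le hq i)
          linarith [hD1 i]
      _ = 10 / 16 * w i := mul_comm _ _
  have ha : Summable fun i => p i * F (node q i) := by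
    refine Summable.of_norm_bounded (hws.mul_left C) fun i => ?_
    rw [Real.norm_eq_abs, abs_mul]
    calc |p i| * |F (node q i)| ≤ |p i| * (C * node q i ^ N) := by
          gcongr
          exact hF _ (node_pos hq i) (mul_node_le hq i)
      _ = C * w i := by simp only [hw]; ring
  -- The functional equation turns the `i`-th term into `p i * F (node q i) - p (i + 1) * F (node q
  -- (i + 1))`.
  have := hasSum_of_telescope ha (t := fun i =>
    (-1) ^ i * r (node q i) * (∏ j ∈ Finset.range i, s (node q j)) / denom q i) ?_
  · simpa [hp, hD] using this
  · intro i
    have h1 := hfun _ (node_pos hq i) (mul_node_le hq i)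
    have hpos : 1 - (q : ℝ) * node q i ≠ 0 := by linarith [hD1 i]
    have hDi := (hDpos i).ne'
    have e : D (i + 1) = D i * (1 - q * node q i) := by simp only [hD, Finset.prod_range_succ]
    rw [hp1, hden, node_succ, e, show r (node q i) =
      (1 - q * node q i) * F (node q i) + s (node q i) * F (node q i ^ 2) by linarith]
    simp only [hp]
    field_simp
    ring

/-! ### Bounds near the poles and summation of the series of `G` and `H` -/

theorem abs_sPoly_mul_le {q ℓ : ℕ} (hq : 2 ≤ q) {x : ℝ} (hx : 0 < x)
    (hqx : q * x ≤ 1 / 2) : |sPoly q ℓ x| * x ^ (2 * ℓ + 1) ≤ 5 * x := by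
  have h2 : (2 : ℝ) ≤ q := by exact_mod_cast hq
  have hx1 : x ≤ 1 := by nlinarith
  have hp : ∀ n, x ^ n ≤ 1 := fun n => pow_le_one₀ hx.le hx1
  have e : sPoly q ℓ x * x ^ (2 * ℓ + 1) = x * (x ^ (2 * ℓ) - q * x * x ^ ℓ + x ^ ℓ) := by
    unfold sPoly
    rw [sub_eq_add_neg (1 : ℤ), zpow_add₀ hx.ne', zpow_one, zpow_neg, zpow_natCast]
    field_simp
    ring
  rw [← abs_of_pos (pow_pos hx (2 * ℓ + 1)), ← abs_mul, e, abs_mul, abs_of_pos hx, mul_comm]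
  gcongr
  have := pow_pos hx ℓ
  have := pow_pos hx (2 * ℓ)
  have := hp ℓ
  have := hp (2 * ℓ)
  have : q * x * x ^ ℓ ≤ 1 := by nlinarith
  have : 0 ≤ q * x * x ^ ℓ := by positivity
  rw [abs_le]
  constructor <;> linarith

theorem abs_vPoly_mul_le {q ℓ : ℕ} (hq : 2 ≤ q) {x : ℝ} (hx : 0 < x)
    (hqx : q * x ≤ 1 / 2) : |vPoly q ℓ x| * x ^ (4 * ℓ + 1) ≤ 5 * x := by
  have h2 : (2 : ℝ) ≤ q := by exact_mod_cast hq
  have hx1 : x ≤ 1 := by nlinarith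
  have hp : ∀ n, x ^ n ≤ 1 := fun n => pow_le_one₀ hx.le hx1
  have e : vPoly q ℓ x * x ^ (4 * ℓ + 1) = x * (x ^ (4 * ℓ) - q * x * x ^ (3 * ℓ) + x ^ (3 * ℓ)
      - q * x * x ^ (2 * ℓ) + x ^ (2 * ℓ)) := by
    unfold vPoly
    rw [sub_eq_add_neg (1 : ℤ), sub_eq_add_neg (1 : ℤ), zpow_add₀ hx.ne', zpow_add₀ hx.ne',
      zpow_one, zpow_neg, zpow_neg, zpow_natCast,
      show (2 * (ℓ : ℤ)) = ((2 * ℓ : ℕ) : ℤ) by push_cast; ring, zpow_natCast]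
    field_simp
    ring
  rw [← abs_of_pos (pow_pos hx (4 * ℓ + 1)), ← abs_mul, e, abs_mul, abs_of_pos hx, mul_comm]
  gcongr
  have := pow_pos hx (3 * ℓ)
  have := pow_pos hx (2 * ℓ)
  have := pow_pos hx (4 * ℓ)
  have := hp (3 * ℓ)
  have := hp (2 * ℓ)
  have := hp (4 * ℓ)
  have : q * x * x ^ (3 * ℓ) ≤ 1 := by nlinarith
  have : q * x * x ^ (2 * ℓ) ≤ 1 := by nlinarith
  have : 0 ≤ q * x * x ^ (2 * ℓ) := by positivity
  have : 0 ≤ q * x * x ^ (3 * ℓ) := by positivity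
  rw [abs_le]
  constructor <;> linarith

theorem hasSum_termG {q ℓ : ℕ} (hq : 2 ≤ q) (hℓ : 1 ≤ ℓ) :
    HasSum (termG q ℓ) (cGen q ℓ (node q 0)) :=
  hasSum_iterate hq (fun _ => cGen_functional hq hℓ)
    (fun _ hx hqx => abs_tsum_mul_pow_le (N := 2 * ℓ + 1) (abs_cSeq_cast_le hq hℓ)
      (fun n hn => by rw [cSeq_of_le q (by omega)]; simp) (by omega) hx.le hqx)
    (fun _ => abs_sPoly_mul_le hq)

theorem hasSum_termH {q ℓ : ℕ} (hq : 2 ≤ q) (hℓ : 1 ≤ ℓ) :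
    HasSum (termH q ℓ) (dGen q ℓ (node q 0)) :=
  hasSum_iterate hq (fun _ => dGen_functional hq hℓ)
    (fun _ hx hqx => abs_tsum_mul_pow_le (N := 4 * ℓ + 1) (abs_dSeq_cast_le hq hℓ)
      (fun n hn => by rw [dSeq_of_le q (by omega)]; simp) (by omega) hx.le hqx)
    (fun _ => abs_vPoly_mul_le hq)

/-- The inner series sums the numbers `c_n + d_n` with weights `q^{-2n}`. -/
theorem hasSum_termG_add_termH {q ℓ : ℕ} (hq : 2 ≤ q) (hℓ : 1 ≤ ℓ) :
    HasSum (fun i => termG q ℓ i + termH q ℓ i)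
      (∑' n, ((cSeq q ℓ n : ℝ) + dSeq q ℓ n) * node q 0 ^ n) := by
  have hx := (node_pos hq 0).le
  have hqx := mul_node_le hq 0
  have h := (hasSum_termG hq hℓ).add (hasSum_termH hq hℓ)
  unfold cGen dGen at h
  rw [← Summable.tsum_add
    (summable_mul_pow (abs_cSeq_cast_le hq hℓ) (by omega) hx hqx)
    (summable_mul_pow (abs_dSeq_cast_le hq hℓ) (by omega) hx hqx)] at h
  simpa only [add_mul] using h

/-! ### Instances of `Z₃` -/

/-- The letter `2` does not occur in `zimin 2`, so its image can be prescribed freely. -/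
theorem isInstance_zimin_three {W : List α} :
    IsInstance (zimin 3) W ↔
      ∃ A C : List α, IsInstance (zimin 2) A ∧ C ≠ [] ∧ W = A ++ (C ++ A) := by
  constructor
  · rintro ⟨φ, hφ, rfl⟩
    exact ⟨(zimin 2).flatMap φ, φ 2, ⟨φ, hφ, rfl⟩, hφ 2, by simp [zimin]⟩
  · rintro ⟨A, C, ⟨φ, hφ, rfl⟩, hC, rfl⟩
    refine ⟨fun x => if x = 2 then C else φ x, fun x => ?_, by simp [zimin]⟩
    dsimp only
    split_ifs
    exacts [hC, hφ x]

theorem ne_nil_of_isInstance_zimin_two {W : List α} (h : IsInstance (zimin 2) W) : W ≠ [] := by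
  obtain ⟨A, B, hA, -, rfl⟩ := isInstance_zimin_two.1 h
  simp [hA]

/-- `Z₂`-instances of length `m` without a bifix that is a `Z₂`-instance. -/
def primitiveInstances (α : Type*) (m : ℕ) : Set (List α) :=
  {W | W.length = m ∧ IsInstance (zimin 2) W ∧ InstanceBifixFree (zimin 2) W}

theorem ncard_primitiveInstances_le [Fintype α] (m : ℕ) :
    (primitiveInstances α m).ncard ≤ Fintype.card α ^ m := by
  rw [← ncard_words]
  exact Set.ncard_le_ncard (fun _ h => h.1) (finite_words m)

theorem ncard_biUnion_finset {ι β : Type*} (t : Finset ι) {s : ι → Set β}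
    (hs : ∀ i ∈ t, (s i).Finite) (h : (t : Set ι).PairwiseDisjoint s) :
    (⋃ i ∈ t, s i).ncard = ∑ i ∈ t, (s i).ncard := by
  have := t.finite_toSet.ncard_biUnion (s := s) hs h
  rwa [finsum_mem_coe_finset] at this

/-- Words of length `n` with a border in `primitiveInstances α m`. -/
def primitiveBorderWords (α : Type*) (n m : ℕ) : Set (List α) :=
  {W | W.length = n ∧ ∃ A ∈ primitiveInstances α m, Border A W}

theorem ncard_primitiveBorderWords [Fintype α] {n m : ℕ} (h : 2 * m < n) :
    (primitiveBorderWords α n m).ncard =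
      (primitiveInstances α m).ncard * Fintype.card α ^ (n - 2 * m) := by
  have : primitiveBorderWords α n m = (fun x : List α × List α => x.1 ++ (x.2 ++ x.1)) ''
      (primitiveInstances α m ×ˢ {C | C.length = n - 2 * m}) := by
    ext W
    constructor
    · rintro ⟨h1, A, hA, hAW⟩
      have hl := hA.1
      obtain ⟨C, rfl⟩ := hAW.exists_eq_append (by omega)
      simp only [List.length_append] at h1
      exact ⟨(A, C), ⟨hA, show C.length = n - 2 * m by omega⟩, rfl⟩
    · rintro ⟨⟨A, C⟩, ⟨hA, hC⟩, rfl⟩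
      have hl := hA.1
      change C.length = n - 2 * m at hC
      dsimp only at hl ⊢
      exact ⟨by simp only [List.length_append]; omega, A, hA, Border.append⟩
  rw [this, Set.InjOn.ncard_image, Set.ncard_prod, ncard_words]
  rintro ⟨A, C⟩ ⟨hA, hC⟩ ⟨A', C'⟩ ⟨hA', hC'⟩ e
  obtain ⟨rfl, e2⟩ := List.append_inj e (hA.1.trans hA'.1.symm)
  obtain ⟨rfl, -⟩ := List.append_inj e2 (hC.trans hC'.symm)
  rfl

/-- Borders of one word are nested, so the shorter one would be a `Z₂`-bifix of the longer one. -/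
theorem disjoint_primitiveBorderWords {n m m' : ℕ} (h : m < m') :
    Disjoint (primitiveBorderWords α n m) (primitiveBorderWords α n m') := by
  rw [Set.disjoint_left]
  rintro W ⟨-, A, hA, hAW⟩ ⟨-, A', hA', hAW'⟩
  have h1 := hA.1
  have h2 := hA'.1
  refine hA'.2.2 A ⟨ne_nil_of_isInstance_zimin_two hA.2.1, ?_, hAW.of_length_le hAW' (by omega)⟩
    hA.2.1
  rintro rfl; omega

theorem isInstance_zimin_three_eq (n : ℕ) :
    {W : List α | W.length = n ∧ IsInstance (zimin 3) W} =
      ⋃ m ∈ Finset.range ((n + 1) / 2), primitiveBorderWords α n m := by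
  ext W
  simp only [Set.mem_iUnion, Finset.mem_range, exists_prop]
  constructor
  · rintro ⟨h1, h2⟩
    obtain ⟨A, C, hA, hC, hW⟩ := isInstance_zimin_three.1 h2
    have hAW : Border A W := hW ▸ Border.append
    have hAl : 2 * A.length < W.length := by
      have := List.length_pos_of_ne_nil hC
      rw [hW]; simp only [List.length_append]; omega
    classical
    -- The shortest border that is a `Z₂`-instance has no `Z₂`-bifix, and being no longer than `A`
    -- it stays below half of `W`; the range bound says exactly `2 * m < n`.
    have hex : ∃ k, ∃ U, Border U W ∧ IsInstance (zimin 2) U ∧ U.length = k := ⟨_, A, hAW, hA, rfl⟩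
    obtain ⟨U, hU, hUI, hUl⟩ := Nat.find_spec hex
    have hle : U.length ≤ A.length := hUl ▸ Nat.find_min' hex ⟨A, hAW, hA, rfl⟩
    refine ⟨U.length, by omega, h1, U, ⟨rfl, hUI, ?_⟩, hU⟩
    rintro V ⟨-, hne, hV⟩ hVI
    exact Nat.find_min hex (hUl ▸ Border.length_lt hV hne) ⟨V, Border.trans hV hU, hVI, rfl⟩
  · rintro ⟨m, hm, h1, A, hA, hAW⟩
    have hl := hA.1
    refine ⟨h1, isInstance_zimin_three.2 ?_⟩
    obtain ⟨C, rfl⟩ := hAW.exists_eq_append (by omega)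
    refine ⟨A, C, hA.2.1, ?_, rfl⟩
    rintro rfl
    simp only [List.length_append, List.length_nil] at h1
    omega

theorem instanceProb_zimin_three {q : ℕ} (hq : 2 ≤ q) (n : ℕ) :
    instanceProb (zimin 3) q n = ∑ m ∈ Finset.range ((n + 1) / 2),
      ((primitiveInstances (Fin q) m).ncard : ℝ) * node q 0 ^ m := by
  have h0 : (q : ℝ) ≠ 0 := by exact_mod_cast (by omega : q ≠ 0)
  unfold instanceProb
  rw [isInstance_zimin_three_eq, ncard_biUnion_finset]
  · push_cast
    rw [Finset.sum_div]
    refine Finset.sum_congr rfl fun m hm => ?_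
    have hm' : 2 * m < n := by have := Finset.mem_range.1 hm; omega
    rw [ncard_primitiveBorderWords hm', Fintype.card_fin, node_eq]
    obtain ⟨k, rfl⟩ := Nat.exists_eq_add_of_lt hm'
    rw [show 2 * m + k + 1 - 2 * m = k + 1 by omega]
    push_cast
    rw [← pow_mul, inv_pow, add_assoc, pow_add]
    field_simp
    ring
  · exact fun m _ => (finite_words n).subset fun _ h => h.1
  · intro m _ m' _ hne
    rcases Nat.lt_or_gt_of_ne hne with h | h
    · exact disjoint_primitiveBorderWords h
    · exact (disjoint_primitiveBorderWords h).symm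

/-! ### Sorting primitive instances by their shortest bifix -/

theorem BifixFree.unique {L L' W : List α} (hL : BifixFree L) (hL' : BifixFree L')
    (h : Border L W) (h' : Border L' W) : L = L' :=
  hL'.eq_of_border (hL.border h h' hL'.1) hL.1

theorem exists_bifixFree_bifix {W : List α} (hW : IsInstance (zimin 2) W) :
    ∃ L, BifixFree L ∧ IsBifix L W := by
  obtain ⟨A, B, hA, hB, rfl⟩ := isInstance_zimin_two.1 hW
  classical
  -- The shortest nonempty border of `A` is bifix-free.
  have hex : ∃ k, ∃ U, Border U A ∧ U ≠ [] ∧ U.length = k := ⟨_, A, Border.refl A, hA, rfl⟩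
  obtain ⟨L, hLA, hL0, hLl⟩ := Nat.find_spec hex
  refine ⟨L, ⟨hL0, ?_⟩, hL0, ?_, hLA.trans Border.append⟩
  · rintro V ⟨hV0, hne, hV⟩
    exact Nat.find_min hex (hLl ▸ Border.length_lt hV hne) ⟨V, Border.trans hV hLA, hV0, rfl⟩
  · rintro rfl
    have := hLA.length_le
    have := List.length_pos_of_ne_nil hB
    have := List.length_pos_of_ne_nil hA
    simp only [List.length_append] at *
    omega

/-- The words in `primitiveInstances α m` with a bifix-free bifix of length `ℓ`. -/
def primitiveInstancesWithBifix (α : Type*) (ℓ m : ℕ) : Set (List α) :=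
  {W | W ∈ primitiveInstances α m ∧ ∃ L, L.length = ℓ ∧ BifixFree L ∧ IsBifix L W}

theorem primitiveInstances_eq (m : ℕ) :
    primitiveInstances α m =
      ⋃ ℓ ∈ Finset.range m, primitiveInstancesWithBifix α (ℓ + 1) m := by
  ext W
  simp only [Set.mem_iUnion, Finset.mem_range, exists_prop]
  constructor
  · intro hW
    obtain ⟨L, hL, hLW⟩ := exists_bifixFree_bifix hW.2.1
    have h1 := hL.length_pos
    have h2 := Border.length_le hLW.2.2
    have h3 := hW.1
    exact ⟨L.length - 1, by omega, hW, L, by omega, hL, hLW⟩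
  · rintro ⟨ℓ, -, hW, -⟩
    exact hW

theorem disjoint_primitiveInstancesWithBifix {ℓ ℓ' m : ℕ} (h : ℓ ≠ ℓ') :
    Disjoint (primitiveInstancesWithBifix α ℓ m) (primitiveInstancesWithBifix α ℓ' m) := by
  rw [Set.disjoint_left]
  rintro W ⟨-, L, hl, hL, hLW⟩ ⟨-, L', hl', hL', hLW'⟩
  exact h (by rw [← hl, ← hl', hL.unique hL' hLW.2.2 hLW'.2.2])

theorem primitiveInstancesWithBifix_of_lt {ℓ m : ℕ} (h : m < ℓ) :
    primitiveInstancesWithBifix α ℓ m = ∅ := by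
  rw [Set.eq_empty_iff_forall_notMem]
  rintro W ⟨hW, L, hl, -, hLW⟩
  have := Border.length_le hLW.2.2
  have := hW.1
  omega

theorem ncard_primitiveInstancesWithBifix (q ℓ m : ℕ) :
    ((primitiveInstancesWithBifix (Fin q) ℓ m).ncard : ℤ) =
      bifixFreeCount q ℓ * (cSeq q ℓ m + dSeq q ℓ m) := by
  have hfin : {L : List (Fin q) | L.length = ℓ ∧ BifixFree L}.Finite :=
    (finite_words ℓ).subset fun _ h => h.1
  have : primitiveInstancesWithBifix (Fin q) ℓ m =
      ⋃ L ∈ hfin.toFinset, z2BifixFreeWords L m := by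
    ext W
    simp only [Set.mem_iUnion, Set.Finite.mem_toFinset, exists_prop]
    constructor
    · rintro ⟨hW, L, hl, hL, hLW⟩
      exact ⟨L, ⟨hl, hL⟩, hW.1, hW.2.1, hLW, hW.2.2⟩
    · rintro ⟨L, ⟨hl, hL⟩, h1, h2, h3, h4⟩
      exact ⟨⟨h1, h2, h4⟩, L, hl, hL, h3⟩
  rw [this, ncard_biUnion_finset, bifixFreeCount, Set.ncard_eq_toFinset_card _ hfin]
  · push_cast
    rw [← nsmul_eq_mul]
    refine Finset.sum_eq_card_nsmul fun L hL => ?_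
    obtain ⟨rfl, hLf⟩ := hfin.mem_toFinset.1 hL
    exact hLf.z2BifixFreeCount_eq m
  · exact fun L _ => (finite_words m).subset fun _ h => h.1
  · intro L hL L' hL' hne
    refine Set.disjoint_left.2 fun W hW hW' => hne ?_
    exact BifixFree.unique (hfin.mem_toFinset.1 hL).2 (hfin.mem_toFinset.1 hL').2
      hW.2.2.1.2.2 hW'.2.2.1.2.2

theorem hasSum_ncard_primitiveInstancesWithBifix (q m : ℕ) :
    HasSum (fun ℓ => ((primitiveInstancesWithBifix (Fin q) (ℓ + 1) m).ncard : ℝ))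
      ((primitiveInstances (Fin q) m).ncard : ℝ) := by
  rw [primitiveInstances_eq, ncard_biUnion_finset]
  · push_cast
    refine hasSum_sum_of_ne_finset_zero fun ℓ hℓ => ?_
    rw [primitiveInstancesWithBifix_of_lt (by simpa using Nat.lt_succ_of_le (by simpa using hℓ))]
    simp
  · exact fun ℓ _ => (finite_words m).subset fun _ h => h.1.1
  · exact fun ℓ _ ℓ' _ hne => disjoint_primitiveInstancesWithBifix (by simpa using hne)

theorem summable_primitiveInstances {q : ℕ} (hq : 2 ≤ q) :
    Summable fun m => ((primitiveInstances (Fin q) m).ncard : ℝ) * node q 0 ^ m := by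
  refine summable_mul_pow (q := q) (fun m => ?_) (by omega) (node_pos hq 0).le (mul_node_le hq 0)
  have := ncard_primitiveInstances_le (α := Fin q) m
  rw [Fintype.card_fin] at this
  rw [abs_of_nonneg (Nat.cast_nonneg _)]
  have : ((primitiveInstances (Fin q) m).ncard : ℝ) ≤ (q : ℝ) ^ m := by exact_mod_cast this
  linarith

/-- All terms are nonnegative, so summing first over the bifix length reduces the claim to the
single series over `m`. The terms of `G` and `H` carry signs, hence the exchange is made here. -/
theorem summable_primitiveInstancesWithBifix {q : ℕ} (hq : 2 ≤ q) :
    Summable fun x : ℕ × ℕ =>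
      ((primitiveInstancesWithBifix (Fin q) (x.2 + 1) x.1).ncard : ℝ) * node q 0 ^ x.1 := by
  have hx := (node_pos hq 0).le
  rw [summable_prod_of_nonneg fun x => by positivity]
  have h := fun m => (hasSum_ncard_primitiveInstancesWithBifix q m).mul_right (node q 0 ^ m)
  refine ⟨fun m => (h m).summable, ?_⟩
  simpa only [(h _).tsum_eq] using summable_primitiveInstances hq

theorem tsum_primitiveInstancesWithBifix {q : ℕ} (hq : 2 ≤ q) (ℓ : ℕ) :
    ∑' m, ((primitiveInstancesWithBifix (Fin q) (ℓ + 1) m).ncard : ℝ) * node q 0 ^ m =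
      (bifixFreeCount q (ℓ + 1) : ℝ) * ∑' i, (termG q (ℓ + 1) i + termH q (ℓ + 1) i) := by
  rw [(hasSum_termG_add_termH hq (Nat.succ_pos ℓ)).tsum_eq, ← tsum_mul_left]
  refine tsum_congr fun m => ?_
  have : ((primitiveInstancesWithBifix (Fin q) (ℓ + 1) m).ncard : ℝ) =
      bifixFreeCount q (ℓ + 1) * ((cSeq q (ℓ + 1) m : ℝ) + dSeq q (ℓ + 1) m) := by
    exact_mod_cast ncard_primitiveInstancesWithBifix q (ℓ + 1) m
  rw [this, mul_assoc]

end FreeWord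

/-- The outer series over `ℓ ≥ 1` is indexed by `ℓ + 1` with `ℓ : ℕ`. -/
theorem mainTheorem11 (q : ℕ) (hq : 2 ≤ q) :
    (∀ L : List (Fin q), BifixFree L → ∀ n : ℕ,
      (z2BifixFreeCount L n : ℤ) = cSeq q L.length n + dSeq q L.length n) ∧
    (∀ ℓ : ℕ, 1 ≤ ℓ → Summable (fun i : ℕ => termG q ℓ i + termH q ℓ i)) ∧
    Summable (fun ℓ : ℕ =>
      (bifixFreeCount q (ℓ + 1) : ℝ) * ∑' i : ℕ, (termG q (ℓ + 1) i + termH q (ℓ + 1) i)) ∧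
    Tendsto (fun n : ℕ => instanceProb (zimin 3) q n) atTop
      (𝓝 (∑' ℓ : ℕ,
        (bifixFreeCount q (ℓ + 1) : ℝ) * ∑' i : ℕ, (termG q (ℓ + 1) i + termH q (ℓ + 1) i))) := by
  have hsum := summable_primitiveInstancesWithBifix hq
  refine ⟨fun L hL n => hL.z2BifixFreeCount_eq n,
    fun ℓ hℓ => (hasSum_termG_add_termH hq hℓ).summable, ?_, ?_⟩
  · simp only [← tsum_primitiveInstancesWithBifix hq]
    exact hsum.prod_symm.prod
  · have hcomm := hsum.tsum_comm (f := fun m ℓ =>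
      ((primitiveInstancesWithBifix (Fin q) (ℓ + 1) m).ncard : ℝ) * node q 0 ^ m)
    have h := fun m =>
      (hasSum_ncard_primitiveInstancesWithBifix q m).mul_right (node q 0 ^ m)
    simp only [tsum_primitiveInstancesWithBifix hq, (h _).tsum_eq] at hcomm
    rw [hcomm]
    refine ((summable_primitiveInstances hq).hasSum.tendsto_sum_nat.comp
      (tendsto_atTop.2 fun b => ?_ : Tendsto (fun n : ℕ => (n + 1) / 2) atTop atTop)).congr
      fun n => (instanceProb_zimin_three hq n).symm
    filter_upwards [eventually_ge_atTop (2 * b)] with n hn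
    omega
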